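/- Let $k$ be a commutative ring and let $A$ be a dg algebra over $k$. Let $A_t$ be a formal cdg deformation of $A$: a curved dg (cdg) algebra over $k[[t]]$, with predifferential $d$ of degree $1$ and curvature $c\in A_t^2$ (so $dc=0$ and $d^2=[c,-]$), which is $t$-torsion-free and is equipped with an isomorphism of cdg algebras $A_t/tA_t\cong A$. (For example, any cdg algebra structure on $A[[t]]$ or on $A\otimes_k k[[t]]$ that reduces modulo $t$ to the dg algebra structure of $A$.) Then $c\in tA_t$, and we write $\frac ct$ for the unique element with $t\cdot\frac ct=c$. A (left) cdg $A_t$-module is a graded $A_t$-module $M$ with a degree $1$ derivation $d_M$ over $d$ such that $d_M^2=c\cdot$. Let $\operatorname{Hot}(A_t)$ be the triangulated category of cdg $A_t$-modules and closed degree $0$ morphisms up to homotopy. A module $M$ is torsion if each of its elements is annihilated by a power of $t$; let $\operatorname{Hot}(A_t)^{tor}\subseteq\operatorname{Hot}(A_t)$ be the full triangulated subcategory of torsion modules. A torsion module $M$ is $t$-acyclic if for every $i\ge 0$ the complex $\operatorname{Ker}t_M^{i+1}/\operatorname{Ker}t_M^{i}$ is acyclic. The torsion $t$-derived category $D^t(A_t)^{tor}$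 is the Verdier quotient of $\operatorname{Hot}(A_t)^{tor}$ by the $t$-acyclic modules. For $n\ge 0$ put $A_n=A_t/t^{n+1}A_t$ and $A_{-1}=0$, let $\pi\colon A_n\to A_{n-1}$ be the projection, and let $\Gamma_n$ be the torsion cdg $A_t$-module with underlying graded module $A_n\oplus A_{n-1}[1]$ and predifferential $$d(a,b)=\bigl(da+tb,\ -db+\pi(a\cdot\tfrac ct)\bigr).$$ Then: 1. every $\Gamma_n$ is homotopy projective: $\operatorname{Hom}_{\operatorname{Hot}(A_t)^{tor}}(\Gamma_n,N)=0$ for every $t$-acyclic torsion module $N$; 2. the category $D^t(A_t)^{tor}$ has arbitrary (small) coproducts, and every $\Gamma_n$ is a compact object of it: $\operatorname{Hom}_{D^t(A_t)^{tor}}(\Gamma_n,-)$ commutes with coproducts; 3. the modules $\Gamma_0,\Gamma_1,\dots$ generate $D^t(A_t)^{tor}$: an object $Y$ of $D^t(A_t)^{tor}$ is zero if and only if $\operatorname{Hom}_{D^t(A_t)^{tor}}(\Gamma_n[l],Y)=0$ for all $n\ge 0$ and $l\in\mathbb Z$. -/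

import Mathlib

open CategoryTheory CategoryTheory.Limits CategoryTheory.Pretriangulated
open scoped PowerSeries

universe u

set_option linter.unusedVariables false

/-- A curved differential graded algebra over a commutative ring `R`: a `ℤ`-graded associative
unital `R`-algebra, given by its homogeneous components `X i`, with an `R`-linear derivation `d`
of degree `1` (the predifferential) and a curvature element `curv` of degree `2` such that
`d curv = 0` and `d (d a) = curv * a - a * curv`.  The operations take a proof that degrees add
up, which avoids transports between components. -/
structure CDGAlg (R : Type u) [CommRing R] where
  X : ℤ → Type u
  [grp : ∀ i, AddCommGroup (X i)]
  [mod : ∀ i, Module R (X i)]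
  one : X 0
  mul : ∀ {i j l : ℤ}, i + j = l → X i →ₗ[R] X j →ₗ[R] X l
  d : ∀ {i j : ℤ}, i + 1 = j → X i →ₗ[R] X j
  curv : X 2
  one_mul : ∀ {i : ℤ} (a : X i), mul (zero_add i) one a = a
  mul_one : ∀ {i : ℤ} (a : X i), mul (add_zero i) a one = a
  mul_assoc : ∀ {i j l ij jl n : ℤ} (h₁ : i + j = ij) (h₂ : ij + l = n) (h₃ : j + l = jl)
    (h₄ : i + jl = n) (a : X i) (b : X j) (c : X l),
    mul h₂ (mul h₁ a b) c = mul h₄ a (mul h₃ b c)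
  leibniz : ∀ {i j l i' j' l' : ℤ} (h : i + j = l) (hi : i + 1 = i') (hj : j + 1 = j')
    (hl : l + 1 = l') (h₁ : i' + j = l') (h₂ : i + j' = l') (a : X i) (b : X j),
    d hl (mul h a b) = mul h₁ (d hi a) b + i.negOnePow • mul h₂ a (d hj b)
  d_curv : d (show (2 : ℤ) + 1 = 3 by norm_num) curv = 0
  d_d : ∀ {i j l : ℤ} (h : i + 1 = j) (h' : j + 1 = l) (h₁ : 2 + i = l) (h₂ : i + 2 = l) (a : X i),
    d h' (d h a) = mul h₁ curv a - mul h₂ a curv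

attribute [instance] CDGAlg.grp CDGAlg.mod

/-- A left cdg module over a cdg algebra `𝒜`: a graded left `𝒜`-module with a derivation `d` of
degree `1` over the predifferential of `𝒜`, such that `d (d m) = curv * m`. -/
structure CDGMod {R : Type u} [CommRing R] (𝒜 : CDGAlg R) where
  X : ℤ → Type u
  [grp : ∀ i, AddCommGroup (X i)]
  [mod : ∀ i, Module R (X i)]
  act : ∀ {i j l : ℤ}, i + j = l → 𝒜.X i →ₗ[R] X j →ₗ[R] X l
  d : ∀ {i j : ℤ}, i + 1 = j → X i →ₗ[R] X j
  one_act : ∀ {i : ℤ} (m : X i), act (zero_add i) 𝒜.one m = m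
  mul_act : ∀ {i j l ij jl n : ℤ} (h₁ : i + j = ij) (h₂ : ij + l = n) (h₃ : j + l = jl)
    (h₄ : i + jl = n) (a : 𝒜.X i) (b : 𝒜.X j) (m : X l),
    act h₂ (𝒜.mul h₁ a b) m = act h₄ a (act h₃ b m)
  leibniz : ∀ {i j l i' j' l' : ℤ} (h : i + j = l) (hi : i + 1 = i') (hj : j + 1 = j')
    (hl : l + 1 = l') (h₁ : i' + j = l') (h₂ : i + j' = l') (a : 𝒜.X i) (m : X j),
    d hl (act h a m) = act h₁ (𝒜.d hi a) m + i.negOnePow • act h₂ a (d hj m)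
  d_d : ∀ {i j l : ℤ} (h : i + 1 = j) (h' : j + 1 = l) (h₁ : 2 + i = l) (m : X i),
    d h' (d h m) = act h₁ 𝒜.curv m

attribute [instance] CDGMod.grp CDGMod.mod

namespace CDGMod

variable {R : Type u} [CommRing R] {𝒜 : CDGAlg R}

/-- Closed morphisms of degree `0` between cdg modules. -/
@[ext]
structure Hom (M N : CDGMod 𝒜) where
  f : ∀ i : ℤ, M.X i →ₗ[R] N.X i
  map_act : ∀ {i j l : ℤ} (h : i + j = l) (a : 𝒜.X i) (m : M.X j),
    f l (M.act h a m) = N.act h a (f j m)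
  map_d : ∀ {i j : ℤ} (h : i + 1 = j) (m : M.X i), f j (M.d h m) = N.d h (f i m)

/-- The category of cdg `𝒜`-modules and closed morphisms of degree `0`. -/
instance : Category (CDGMod 𝒜) where
  Hom M N := Hom M N
  id M := ⟨fun _ => LinearMap.id, by simp, by simp⟩
  comp f g := ⟨fun i => (g.f i).comp (f.f i), by simp [f.map_act, g.map_act],
    by simp [f.map_d, g.map_d]⟩

@[ext]
lemma hom_ext {M N : CDGMod 𝒜} {f g : M ⟶ N} (h : ∀ i m, Hom.f f i m = Hom.f g i m) : f = g := by
  apply Hom.ext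
  funext i
  ext m
  exact h i m

@[simp] lemma id_f (M : CDGMod 𝒜) (i : ℤ) (m : M.X i) : Hom.f (𝟙 M) i m = m := rfl
@[simp] lemma comp_f {M N P : CDGMod 𝒜} (f : M ⟶ N) (g : N ⟶ P) (i : ℤ) (m : M.X i) :
    Hom.f (f ≫ g) i m = g.f i (f.f i m) := rfl

lemma units_cases (e : ℤˣ) : e = 1 ∨ e = -1 := Int.units_eq_one_or e

section
variable {M N : CDGMod 𝒜}

instance : Zero (M ⟶ N) := ⟨⟨fun _ => 0, by simp, by simp⟩⟩
instance : Add (M ⟶ N) := ⟨fun f g => ⟨fun i => f.f i + g.f i,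
  by simp [f.map_act, g.map_act], by simp [f.map_d, g.map_d]⟩⟩
instance : Neg (M ⟶ N) := ⟨fun f => ⟨fun i => - f.f i,
  by simp [f.map_act], by simp [f.map_d]⟩⟩

@[simp] lemma zero_f (i : ℤ) (m : M.X i) : Hom.f (0 : M ⟶ N) i m = 0 := rfl
@[simp] lemma add_f (f g : M ⟶ N) (i : ℤ) (m : M.X i) :
    Hom.f (f + g) i m = f.f i m + g.f i m := rfl
@[simp] lemma neg_f (f : M ⟶ N) (i : ℤ) (m : M.X i) : Hom.f (-f) i m = - f.f i m := rfl

instance : AddCommGroup (M ⟶ N) where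
  add_assoc f g h := by ext; simp [add_assoc]
  zero_add f := by ext; simp
  add_zero f := by ext; simp
  add_comm f g := by ext; simp [add_comm]
  neg_add_cancel f := by ext; simp
  nsmul := nsmulRec
  zsmul := zsmulRec

@[simp] lemma sub_f (f g : M ⟶ N) (i : ℤ) (m : M.X i) :
    Hom.f (f - g) i m = f.f i m - g.f i m := by
  rw [sub_eq_add_neg, add_f, neg_f, sub_eq_add_neg]

end

instance : Preadditive (CDGMod 𝒜) where
  add_comp _ _ _ f f' g := by ext; simp
  comp_add _ _ _ f g g' := by ext; simp

/-! ### Transport along equalities of degrees -/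

/-- The identification of two homogeneous components of equal degrees. -/
def cast (M : CDGMod 𝒜) {i j : ℤ} (h : i = j) : M.X i →ₗ[R] M.X j := by
  subst h; exact LinearMap.id

section
variable (M : CDGMod 𝒜)

@[simp] lemma cast_rfl {i : ℤ} (h : i = i) (m : M.X i) : M.cast h m = m := rfl
@[simp] lemma cast_cast {i j l : ℤ} (h : i = j) (h' : j = l) (m : M.X i) :
    M.cast h' (M.cast h m) = M.cast (h.trans h') m := by subst h h'; rfl
@[simp] lemma d_cast {i j l : ℤ} (h : i = j) (h' : j + 1 = l) (m : M.X i) :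
    M.d h' (M.cast h m) = M.d (by rw [h, h']) m := by subst h; rfl
@[simp] lemma cast_d {i j l : ℤ} (h : i + 1 = j) (h' : j = l) (m : M.X i) :
    M.cast h' (M.d h m) = M.d (by rw [h, h']) m := by subst h'; rfl
@[simp] lemma act_cast {i j j' l : ℤ} (h : j = j') (h' : i + j' = l) (a : 𝒜.X i) (m : M.X j) :
    M.act h' a (M.cast h m) = M.act (by rw [h, h']) a m := by subst h; rfl
@[simp] lemma cast_act {i j l l' : ℤ} (h : i + j = l) (h' : l = l') (a : 𝒜.X i) (m : M.X j) :
    M.cast h' (M.act h a m) = M.act (by rw [h, h']) a m := by subst h'; rfl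

end

lemma Hom.map_cast {M N : CDGMod 𝒜} (f : M ⟶ N) {i j : ℤ} (h : i = j) (m : M.X i) :
    Hom.f f j (M.cast h m) = N.cast h (Hom.f f i m) := by subst h; rfl

@[simp] lemma eqToHom_f {M N : CDGMod 𝒜} (h : M = N) (i : ℤ) (m : M.X i) :
  Hom.f (eqToHom h) i m = _root_.cast (by rw [h]) m := by subst h; rfl

/-! ### Shifts -/

/-- The shift `M[n]`: `M[n]ⁱ = Mⁱ⁺ⁿ`, with predifferential `(-1)ⁿ d` and the action of a
homogeneous element `a` multiplied by `(-1)^(n|a|)`. -/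
abbrev shift (M : CDGMod 𝒜) (n : ℤ) : CDGMod 𝒜 where
  X i := M.X (i + n)
  act {i _ _} h := (n * i).negOnePow • M.act (by lia)
  d h := n.negOnePow • M.d (by lia)
  one_act {i} m := by
    have := M.one_act m
    simp
    exact this
  mul_act {i j l ij jl k} h₁ h₂ h₃ h₄ a b m := by
    subst h₁
    have e := M.mul_act rfl (show (i + j) + (l + n) = k + n by lia)
      (show j + (l + n) = jl + n by lia) (show i + (jl + n) = k + n by lia) a b m
    rcases units_cases (n * i).negOnePow with h | h <;>
    rcases units_cases (n * j).negOnePow with h' | h' <;>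
    simp [mul_add, Int.negOnePow_add, h, h', e]
  leibniz {i j l i' j' l'} h hi hj hl h₁ h₂ a m := by
    subst hi
    have e := M.leibniz (show i + (j + n) = l + n by lia) rfl (show (j + n) + 1 = j' + n by lia)
      (show (l + n) + 1 = l' + n by lia) (by lia) (by lia) a m
    rcases units_cases (n * i).negOnePow with h | h <;>
    rcases units_cases n.negOnePow with h' | h' <;>
    rcases units_cases i.negOnePow with h'' | h'' <;>
    simp [mul_add, Int.negOnePow_add, h, h', h'', e] <;> abel
  d_d {i j l} h h' h₁ m := by
    have e := M.d_d (show (i + n) + 1 = j + n by lia) (show (j + n) + 1 = l + n by lia)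
      (by lia) m
    have h2 : (n * 2).negOnePow = 1 := Int.negOnePow_even _ (by simp)
    rcases units_cases n.negOnePow with h' | h' <;>
    simp [h2, h', e]

section
variable (M : CDGMod 𝒜) (n : ℤ)

lemma shift_act {i j l : ℤ} (h : i + j = l) (a : 𝒜.X i) (m : (M.shift n).X j) :
    (M.shift n).act h a m = (n * i).negOnePow • M.act (by lia) a m := rfl
lemma shift_d {i j : ℤ} (h : i + 1 = j) (m : (M.shift n).X i) :
    (M.shift n).d h m = n.negOnePow • M.d (by lia) m := rfl
lemma shift_cast {i j : ℤ} (h : i = j) (m : (M.shift n).X i) :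
    (M.shift n).cast h m = M.cast (by rw [h]) m := by subst h; rfl

end

lemma map_units {V W : Type u} [AddCommGroup V] [AddCommGroup W] [Module R V] [Module R W]
    (f : V →ₗ[R] W) (e : ℤˣ) (v : V) : f (e • v) = e • f v := by
  rcases units_cases e with h | h <;> simp [h]

/-- The shift functors on cdg modules. -/
def shiftFun (𝒜 : CDGAlg R) (n : ℤ) : CDGMod 𝒜 ⥤ CDGMod 𝒜 where
  obj M := M.shift n
  map {M N} f := ⟨fun i => f.f (i + n),
    fun {i j l} h a m => (map_units (f.f (l + n)) _ _).trans
      (congrArg ((n * i).negOnePow • ·) (f.map_act _ a m)),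
    fun {i j} h m => (map_units (f.f (j + n)) _ _).trans
      (congrArg (n.negOnePow • ·) (f.map_d _ m))⟩
  map_id M := rfl
  map_comp f g := rfl

lemma shiftFun_map_f {M N : CDGMod 𝒜} (f : M ⟶ N) (n i : ℤ) (m : (M.shift n).X i) :
    Hom.f ((shiftFun 𝒜 n).map f) i m = Hom.f f (i + n) m := rfl

/-- `M[n] ≅ M` for `n = 0`. -/
def shiftZero (M : CDGMod 𝒜) : M.shift 0 ≅ M where
  hom := ⟨fun i => M.cast (add_zero i), fun {i j l} h a m => by
      rw [shift_act, zero_mul, Int.negOnePow_zero, one_smul]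
      exact (M.cast_act _ _ a m).trans (M.act_cast _ _ a m).symm,
    fun {i j} h m => by
      rw [shift_d, Int.negOnePow_zero, one_smul]
      exact (M.cast_d _ _ m).trans (M.d_cast _ _ m).symm⟩
  inv := ⟨fun i => M.cast (add_zero i).symm, fun {i j l} h a m => by
      rw [shift_act, zero_mul, Int.negOnePow_zero, one_smul]
      exact (M.cast_act _ _ a m).trans (M.act_cast _ _ a m).symm,
    fun {i j} h m => by
      rw [shift_d, Int.negOnePow_zero, one_smul]
      exact (M.cast_d _ _ m).trans (M.d_cast _ _ m).symm⟩
  hom_inv_id := by ext i m; exact M.cast_cast _ _ _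
  inv_hom_id := by ext i m; exact M.cast_cast _ _ _

lemma shift_shift_act (M : CDGMod 𝒜) (a b : ℤ) {i j l : ℤ} (h : i + j = l) (x : 𝒜.X i)
    (m : ((M.shift a).shift b).X j) : ((M.shift a).shift b).act h x m =
      ((a + b) * i).negOnePow • M.act (show i + (j + b + a) = l + b + a by lia) x m := by
  rw [shift_act, shift_act, smul_smul, ← Int.negOnePow_add, ← add_mul, add_comm b a]

lemma shift_shift_d (M : CDGMod 𝒜) (a b : ℤ) {i j : ℤ} (h : i + 1 = j)
    (m : ((M.shift a).shift b).X i) : ((M.shift a).shift b).d h m =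
      (a + b).negOnePow • M.d (show (i + b + a) + 1 = j + b + a by lia) m := by
  rw [shift_d, shift_d, smul_smul, ← Int.negOnePow_add, add_comm b a]

/-- `M[n + m] ≅ M[n][m]`. -/
def shiftAdd (M : CDGMod 𝒜) (a b : ℤ) : M.shift (a + b) ≅ (M.shift a).shift b where
  hom := ⟨fun i => M.cast (show i + (a + b) = (i + b) + a by lia), fun {i j l} h x m =>
      (map_units (M.cast _) _ _).trans ((congrArg _
        ((M.cast_act _ _ x m).trans (M.act_cast _ _ x m).symm)).trans
        (shift_shift_act M a b h x _).symm),
    fun {i j} h m => (map_units (M.cast _) _ _).trans ((congrArg _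
        ((M.cast_d _ _ m).trans (M.d_cast _ _ m).symm)).trans (shift_shift_d M a b h _).symm)⟩
  inv := ⟨fun i => M.cast (show (i + b) + a = i + (a + b) by lia), fun {i j l} h x m =>
      (congrArg (M.cast _) (shift_shift_act M a b h x m)).trans
      ((map_units (M.cast _) _ _).trans (congrArg _
        ((M.cast_act _ _ x m).trans (M.act_cast _ _ x m).symm))),
    fun {i j} h m => (congrArg (M.cast _) (shift_shift_d M a b h m)).trans
      ((map_units (M.cast _) _ _).trans (congrArg _
        ((M.cast_d _ _ m).trans (M.d_cast _ _ m).symm)))⟩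
  hom_inv_id := by ext i m; exact M.cast_cast _ _ _
  inv_hom_id := by ext i m; exact M.cast_cast _ _ _

lemma shiftZero_inv_f (M : CDGMod 𝒜) (i : ℤ) (m : M.X i) :
    M.shiftZero.inv.f i m = M.cast (add_zero i).symm m := rfl
lemma shiftAdd_hom_f (M : CDGMod 𝒜) (a b i : ℤ) (m : (M.shift (a + b)).X i) :
    (M.shiftAdd a b).hom.f i m = M.cast (show i + (a + b) = (i + b) + a by lia) m := rfl
lemma shiftAdd_inv_f (M : CDGMod 𝒜) (a b i : ℤ) (m : ((M.shift a).shift b).X i) :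
    (M.shiftAdd a b).inv.f i m = M.cast (show (i + b) + a = i + (a + b) by lia) m := rfl

lemma eqToHom_shift_f (M : CDGMod 𝒜) {a b : ℤ} (h : a = b) (i : ℤ) (m : (M.shift a).X i) :
    Hom.f (eqToHom (show M.shift a = M.shift b by rw [h])) i m = M.cast (by rw [h]) m := by
  subst h; rfl

noncomputable instance : HasShift (CDGMod 𝒜) ℤ := hasShiftMk _ _
  { F := shiftFun 𝒜
    zero := NatIso.ofComponents shiftZero (fun f => by
      ext i m; exact (f.map_cast _ m).symm)
    add := fun a b => NatIso.ofComponents (fun M => shiftAdd M a b) (fun f => by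
      ext i m; exact (f.map_cast _ m).symm)
    assoc_hom_app := fun a b c M => by
      ext i m
      refine (M.cast_cast _ _ _).trans (Eq.trans ?_ (congrArg (fun z => (M.shift a).cast
        (show i + (b + c) = (i + c) + b by lia) (M.cast
        (show i + (a + (b + c)) = (i + (b + c)) + a by lia) z))
        (eqToHom_shift_f M (add_assoc a b c) i m).symm))
      refine Eq.trans ?_ (shift_cast M a _ _).symm
      exact ((M.cast_cast _ _ _).trans (M.cast_cast _ _ _)).symm
    zero_add_hom_app := fun a M => by
      ext i m
      exact Eq.trans (M.cast_cast _ _ _).symm (congrArg (fun z => M.cast _ z)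
        (eqToHom_shift_f M (zero_add a) i m).symm)
    add_zero_hom_app := fun a M => by
      ext i m
      refine Eq.trans ?_ (congrArg (fun z => (M.shift a).cast (add_zero i).symm z)
        (eqToHom_shift_f M (add_zero a) i m).symm)
      exact Eq.trans (M.cast_cast _ _ _).symm (shift_cast M a _ _).symm }

lemma shiftFunctor_eq (n : ℤ) : shiftFunctor (CDGMod 𝒜) n = shiftFun 𝒜 n := rfl

instance (n : ℤ) : (shiftFunctor (CDGMod 𝒜) n).Additive where
  map_add := rfl

end CDGMod

namespace CDGMod

variable {R : Type u} [CommRing R] {𝒜 : CDGAlg R}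

/-! ### Homotopies -/

/-- Homogeneous `𝒜`-linear maps of degree `-1` (not necessarily closed). -/
structure Htpy (M N : CDGMod 𝒜) where
  s : ∀ {i j : ℤ}, j + 1 = i → M.X i →ₗ[R] N.X j
  map_act : ∀ {i j l j' l' : ℤ} (h : i + j = l) (hj : j' + 1 = j) (hl : l' + 1 = l)
    (h' : i + j' = l') (a : 𝒜.X i) (m : M.X j),
    s hl (M.act h a m) = i.negOnePow • N.act h' a (s hj m)

/-- A closed morphism of degree `0` is null-homotopic if it is the differential `d s + s d` of
an `𝒜`-linear map `s` of degree `-1`. -/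
def Null {M N : CDGMod 𝒜} (f : M ⟶ N) : Prop :=
  ∃ σ : Htpy M N, ∀ {i j l : ℤ} (h : j + 1 = i) (h' : i + 1 = l) (m : M.X i),
    Hom.f f i m = N.d h (σ.s h m) + σ.s h' (M.d h' m)

section
variable {M N P : CDGMod 𝒜}

lemma Null.zero : Null (0 : M ⟶ N) := ⟨⟨fun _ => 0, by simp⟩, by simp⟩

lemma Null.sub_of {f g : M ⟶ N} (σ : Htpy M N)
    (h : ∀ {i j l : ℤ} (h : j + 1 = i) (h' : i + 1 = l) (m : M.X i),
      Hom.f f i m = Hom.f g i m + (N.d h (σ.s h m) + σ.s h' (M.d h' m))) : Null (f - g) :=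
  ⟨σ, fun h₁ h₂ m => by rw [sub_f, h h₁ h₂ m, add_sub_cancel_left]⟩

lemma Null.add {f g : M ⟶ N} (hf : Null f) (hg : Null g) : Null (f + g) := by
  obtain ⟨σ, hσ⟩ := hf
  obtain ⟨τ, hτ⟩ := hg
  refine ⟨⟨fun h => σ.s h + τ.s h, fun h hj hl h' a m => ?_⟩, fun h h' m => ?_⟩
  · simp [σ.map_act h hj hl h', τ.map_act h hj hl h']
  · simp only [add_f, LinearMap.add_apply, map_add]
    rw [hσ h h', hτ h h']; abel

lemma Null.neg {f : M ⟶ N} (hf : Null f) : Null (-f) := by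
  obtain ⟨σ, hσ⟩ := hf
  refine ⟨⟨fun h => - σ.s h, fun h hj hl h' a m => ?_⟩, fun h h' m => ?_⟩
  · simp [σ.map_act h hj hl h']
  · simp only [neg_f, LinearMap.neg_apply, map_neg]
    rw [hσ h h']; abel

lemma Null.comp_left (f : M ⟶ N) {g : N ⟶ P} (hg : Null g) : Null (f ≫ g) := by
  obtain ⟨σ, hσ⟩ := hg
  refine ⟨⟨fun {i j} h => (σ.s h).comp (f.f i), fun h hj hl h' a m => ?_⟩, fun h h' m => ?_⟩
  · simp [σ.map_act h hj hl h', f.map_act]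
  · simp [hσ h h', f.map_d]

lemma Null.comp_right {f : M ⟶ N} (hf : Null f) (g : N ⟶ P) : Null (f ≫ g) := by
  obtain ⟨σ, hσ⟩ := hf
  refine ⟨⟨fun {i j} h => (g.f j).comp (σ.s h), fun h hj hl h' a m => ?_⟩, fun h h' m => ?_⟩
  · simp [σ.map_act h hj hl h', g.map_act]
  · simp [hσ h h', g.map_d]

end

/-- The homotopy relation on closed morphisms of degree `0`. -/
def homotopic (𝒜 : CDGAlg R) : HomRel (CDGMod 𝒜) := fun _ _ f g => Null (f - g)

instance : Congruence (homotopic 𝒜) where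
  comp_left f g g' h := by
    simpa [homotopic] using Null.comp_left f h
  comp_right g h := by
    simpa [homotopic] using Null.comp_right h g
  equivalence := ⟨fun f => by simpa [homotopic] using Null.zero,
    fun h => by simpa [homotopic] using h.neg, fun h h' => by simpa [homotopic] using h.add h'⟩

/-- The shift of a homogeneous linear map of degree `-1`. -/
def Htpy.shift {M N : CDGMod 𝒜} (σ : Htpy M N) (n : ℤ) : Htpy (M.shift n) (N.shift n) where
  s h := n.negOnePow • σ.s (by lia)
  map_act {i j l j' l'} h hj hl h' a m := by
    have e := σ.map_act (show i + (j + n) = l + n by lia) (show (j' + n) + 1 = j + n by lia)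
      (show (l' + n) + 1 = l + n by lia) (by lia) a m
    rcases units_cases (n * i).negOnePow with h | h <;>
    rcases units_cases n.negOnePow with h' | h' <;>
    rcases units_cases i.negOnePow with h'' | h'' <;>
    simp [h, h', h'', e]

lemma Null.shift {M N : CDGMod 𝒜} {f : M ⟶ N} (hf : Null f) (n : ℤ) :
    Null (f⟦n⟧') := by
  obtain ⟨σ, hσ⟩ := hf
  refine ⟨σ.shift n, fun {i j l} h h' m => ?_⟩
  refine (hσ (show (j + n) + 1 = i + n by lia) (show (i + n) + 1 = l + n by lia) m).trans ?_
  change _ = n.negOnePow • N.d _ (n.negOnePow • σ.s _ m) +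
    n.negOnePow • σ.s _ (n.negOnePow • M.d _ m)
  rcases units_cases n.negOnePow with h' | h' <;> simp [h'] <;> rfl

instance : (homotopic 𝒜).IsCompatibleWithShift ℤ where
  condition n M N f g h := by
    have := Null.shift h n
    rwa [Functor.map_sub] at this

end CDGMod

open CDGMod

/-- The homotopy category `Hot(𝒜)` of cdg `𝒜`-modules: closed morphisms of degree `0` up to
homotopy. -/
def Hot {R : Type u} [CommRing R] (𝒜 : CDGAlg R) : Type (u + 1) := Quotient (homotopic 𝒜)

namespace Hot

variable {R : Type u} [CommRing R] {𝒜 : CDGAlg R}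

instance : Category (Hot 𝒜) := inferInstanceAs (Category (Quotient (homotopic 𝒜)))

/-- The projection functor to the homotopy category. -/
def quot (𝒜 : CDGAlg R) : CDGMod 𝒜 ⥤ Hot 𝒜 := Quotient.functor _

instance : (quot 𝒜).Full := inferInstanceAs (Quotient.functor (homotopic 𝒜)).Full
instance : (quot 𝒜).EssSurj := inferInstanceAs (Quotient.functor (homotopic 𝒜)).EssSurj

lemma homotopic_add ⦃X Y : CDGMod 𝒜⦄ (f₁ f₂ g₁ g₂ : X ⟶ Y) (h : homotopic 𝒜 f₁ f₂)
    (h' : homotopic 𝒜 g₁ g₂) : homotopic 𝒜 (f₁ + g₁) (f₂ + g₂) := by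
  have := Null.add h h'
  rwa [show f₁ - f₂ + (g₁ - g₂) = f₁ + g₁ - (f₂ + g₂) by abel] at this

instance : Preadditive (Hot 𝒜) := Quotient.preadditive _ homotopic_add

instance : (quot 𝒜).Additive := Quotient.functor_additive _ homotopic_add

noncomputable instance : HasShift (Hot 𝒜) ℤ :=
  inferInstanceAs (HasShift (Quotient (homotopic 𝒜)) ℤ)

noncomputable instance : (quot 𝒜).CommShift ℤ :=
  inferInstanceAs ((Quotient.functor (homotopic 𝒜)).CommShift ℤ)

lemma shift_quot_obj (M : CDGMod 𝒜) (n : ℤ) :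
    ((quot 𝒜).obj M)⟦n⟧ = (quot 𝒜).obj (M⟦n⟧) := Quotient.functor_obj_shift ..

instance (n : ℤ) : (shiftFunctor (Hot 𝒜) n).Additive := by
  have : ((quot 𝒜 ⋙ shiftFunctor _ n)).Additive :=
    Functor.additive_of_iso ((quot 𝒜).commShiftIso n)
  apply Functor.additive_of_full_essSurj_comp (quot 𝒜)

lemma quot_map_eq_iff {M N : CDGMod 𝒜} (f g : M ⟶ N) :
    (quot 𝒜).map f = (quot 𝒜).map g ↔ Null (f - g) :=
  Quotient.functor_map_eq_iff (homotopic 𝒜) f g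

lemma quot_map_eq_zero_iff {M N : CDGMod 𝒜} (f : M ⟶ N) :
    (quot 𝒜).map f = 0 ↔ Null f := by
  rw [← (quot 𝒜).map_zero, quot_map_eq_iff, sub_zero]

lemma isZero_quot_iff (M : CDGMod 𝒜) : IsZero ((quot 𝒜).obj M) ↔ Null (𝟙 M) := by
  rw [IsZero.iff_id_eq_zero, ← (quot 𝒜).map_id, quot_map_eq_zero_iff]

/-- The zero module. -/
def zeroMod (𝒜 : CDGAlg R) : CDGMod 𝒜 where
  X _ := PUnit
  act _ := 0
  d _ := 0
  one_act _ := rfl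
  mul_act _ _ _ _ _ _ _ := rfl
  leibniz _ _ _ _ _ _ _ _ := rfl
  d_d _ _ _ _ := rfl

lemma isZero_zeroMod : IsZero ((quot 𝒜).obj (zeroMod 𝒜)) := by
  rw [isZero_quot_iff]
  exact ⟨⟨fun _ => 0, fun _ _ _ _ _ _ => rfl⟩, fun _ _ _ => rfl⟩

instance : HasZeroObject (Hot 𝒜) := ⟨_, isZero_zeroMod⟩

end Hot

namespace CDGMod

variable {R : Type u} [CommRing R] {𝒜 : CDGAlg R}

/-! ### Cones -/

/-- The cone of a closed morphism `f : M ⟶ N`: the graded module `M[1] ⊕ N` with predifferential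
`(m, n) ↦ (- d m, f m + d n)`. -/
abbrev cone {M N : CDGMod 𝒜} (f : M ⟶ N) : CDGMod 𝒜 where
  X i := M.X (i + 1) × N.X i
  act {i j l} h := LinearMap.mk₂ R
    (fun a x => (i.negOnePow • M.act (show i + (j + 1) = l + 1 by lia) a x.1, N.act h a x.2))
    (fun a b x => by ext <;> simp) (fun r a x => Prod.ext (by simp [smul_comm r]) (by simp))
    (fun a x y => by ext <;> simp) (fun r a x => Prod.ext (by simp [smul_comm r]) (by simp))
  d {i j} h := LinearMap.prod (-(M.d (show i + 1 + 1 = j + 1 by lia)).comp (LinearMap.fst _ _ _))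
    (((f.f j).comp (M.cast h)).comp (LinearMap.fst _ _ _) + (N.d h).comp (LinearMap.snd _ _ _))
  one_act {i} x := Prod.ext (by
    have e := M.one_act x.1
    simp only [LinearMap.mk₂_apply, Int.negOnePow_zero, one_smul]
    exact e) (N.one_act x.2)
  mul_act {i j l ij jl n} h₁ h₂ h₃ h₄ a b x := by
    subst h₁
    have e := M.mul_act rfl (show (i + j) + (l + 1) = n + 1 by lia)
      (show j + (l + 1) = jl + 1 by lia) (show i + (jl + 1) = n + 1 by lia) a b x.1
    refine Prod.ext ?_ (N.mul_act _ _ _ _ _ _ _)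
    simp only [LinearMap.mk₂_apply, e, map_units, smul_smul, Int.negOnePow_add]
  leibniz {i j l i' j' l'} h hi hj hl h₁ h₂ a x := by
    subst hi
    have e := M.leibniz (show i + (j + 1) = l + 1 by lia) rfl (show (j + 1) + 1 = j' + 1 by lia)
      (show (l + 1) + 1 = l' + 1 by lia) (by lia) (by lia) a x.1
    have e' := N.leibniz h rfl hj hl h₁ h₂ a x.2
    have e'' := f.map_act h₂ a (M.cast hj x.1)
    rw [M.act_cast] at e''
    rcases units_cases i.negOnePow with h' | h' <;>
    refine Prod.ext ?_ ?_ <;>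
    simp [h', e, e', e'', Int.negOnePow_succ] <;> abel
  d_d {i j l} h h' h₁ x := by
    have e := M.d_d (show (i + 1) + 1 = j + 1 by lia) (show (j + 1) + 1 = l + 1 by lia)
      (by lia) x.1
    have e' := N.d_d h h' h₁ x.2
    have h2 : (2 : ℤ).negOnePow = 1 := Int.negOnePow_even _ (by simp)
    refine Prod.ext ?_ ?_
    · simp [h2, e]
    · simp [e', ← f.map_d]

section
variable {M N : CDGMod 𝒜} (f : M ⟶ N)

lemma cone_act {i j l : ℤ} (h : i + j = l) (a : 𝒜.X i) (m : M.X (j + 1)) (n : N.X j) :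
    (cone f).act h a (m, n) = (i.negOnePow • M.act (by lia) a m, N.act h a n) := rfl
lemma cone_d {i j : ℤ} (h : i + 1 = j) (m : M.X (i + 1)) (n : N.X i) :
    (cone f).d h (m, n) = (- M.d (by lia) m, Hom.f f j (M.cast h m) + N.d h n) := rfl
lemma cone_cast {i j : ℤ} (h : i = j) (m : M.X (i + 1)) (n : N.X i) :
    (cone f).cast h (m, n) = (M.cast (by rw [h]) m, N.cast h n) := by subst h; rfl

/-- The inclusion of the target into the cone. -/
def coneInr : N ⟶ cone f where
  f i := LinearMap.inr R _ _
  map_act h a n := Prod.ext (by simp) rfl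
  map_d h n := Prod.ext (by simp) (by simp)

/-- The projection of the cone to the shifted source. -/
def coneFst : cone f ⟶ M⟦(1 : ℤ)⟧ where
  f i := (LinearMap.fst R (M.X (i + 1)) (N.X i) : _)
  map_act {i j l} h a x := by
    change i.negOnePow • M.act _ a x.1 = (1 * i).negOnePow • M.act _ a x.1
    rw [_root_.one_mul]
  map_d {i j} h x := by
    change - M.d _ x.1 = (1 : ℤ).negOnePow • M.d _ x.1
    simp

lemma coneInr_f (i : ℤ) (n : N.X i) : (coneInr f).f i n = (0, n) := rfl
lemma coneFst_f (i : ℤ) (x : (cone f).X i) : (coneFst f).f i x = x.1 := rfl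

/-- The triangle `M ⟶ N ⟶ cone f ⟶ M[1]`. -/
noncomputable def triangle : Triangle (CDGMod 𝒜) := Triangle.mk f (coneInr f) (coneFst f)

end

lemma null_id_cone_id (M : CDGMod 𝒜) : Null (𝟙 (cone (𝟙 M))) := by
  refine ⟨⟨fun {i j} h => LinearMap.prod ((M.cast h.symm).comp (LinearMap.snd _ _ _)) 0,
    fun {i j l j' l'} h hj hl h' a x => ?_⟩, fun {i j l} h h' x => ?_⟩
  · refine Prod.ext ?_ ?_
    · rcases units_cases i.negOnePow with h' | h' <;> simp [h']
    · simp
  · refine Prod.ext ?_ ?_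
    · simp; rfl
    · simp; rfl

/-- Morphisms out of cones of homotopy commutative squares. -/
lemma exists_cone_map {M N M' N' : CDGMod 𝒜} (f : M ⟶ N) (f' : M' ⟶ N') (a : M ⟶ M')
    (b : N ⟶ N') (h : Null (f ≫ b - a ≫ f')) :
    ∃ c : cone f ⟶ cone f', coneInr f ≫ c = b ≫ coneInr f' ∧
      coneFst f ≫ a⟦(1 : ℤ)⟧' = c ≫ coneFst f' := by
  obtain ⟨σ, hσ⟩ := h
  refine ⟨⟨fun i => LinearMap.prod ((a.f (i + 1)).comp (LinearMap.fst _ _ _))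
    ((σ.s rfl).comp (LinearMap.fst _ _ _) + (b.f i).comp (LinearMap.snd _ _ _)),
    fun {i j l} h x m => ?_, fun {i j} h m => ?_⟩, ?_, ?_⟩
  · have e := σ.map_act (show i + (j + 1) = l + 1 by lia) rfl rfl h x m.1
    refine Prod.ext ?_ ?_ <;> rcases units_cases i.negOnePow with h' | h' <;>
      simp [h', a.map_act, b.map_act, e]
  · subst h
    have e := hσ rfl rfl m.1
    simp only [sub_f, comp_f] at e
    refine Prod.ext ?_ ?_
    · simp [a.map_d]
    · simp [b.map_d]
      rw [sub_eq_iff_eq_add] at e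
      rw [e]
      abel
  · apply hom_ext
    intro i m
    exact Prod.ext (map_zero (a.f (i + 1))) (by
      change σ.s rfl 0 + Hom.f b i m = Hom.f b i m
      simp)
  · ext i m
    rfl

/-! ### Rotation of the standard triangle -/

section
variable {M N : CDGMod 𝒜} (f : M ⟶ N)

/-- The comparison map `M[1] ⟶ cone (coneInr f)`. -/
def rotHom : M.shift 1 ⟶ cone (coneInr f) where
  f i := LinearMap.prod (-(f.f (i + 1))) (LinearMap.inl R (M.X (i + 1)) (N.X i))
  map_act {i j l} h a m := by
    have h1 : (1 * i).negOnePow = i.negOnePow := by rw [_root_.one_mul]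
    refine Prod.ext ?_ (Prod.ext ?_ ?_) <;> rcases units_cases i.negOnePow with h' | h' <;>
      simp [h', f.map_act]
  map_d {i j} h m := by
    refine Prod.ext ?_ (Prod.ext ?_ ?_)
    · simp [f.map_d]
    · simp
      rfl
    · simp
      change 0 = -(N.cast h (Hom.f f (i + 1) m)) + Hom.f f j (M.cast h m)
      rw [f.map_cast]
      simp

/-- The comparison map `cone (coneInr f) ⟶ M[1]`. -/
def rotInv : cone (coneInr f) ⟶ M.shift 1 where
  f i := (LinearMap.fst R (M.X (i + 1)) (N.X i)).comp
    (LinearMap.snd R (N.X (i + 1)) (M.X (i + 1) × N.X i))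
  map_act {i j l} h a x := by
    change i.negOnePow • M.act _ a x.2.1 = (1 * i).negOnePow • M.act _ a x.2.1
    rw [_root_.one_mul]
  map_d {i j} h x := by
    simp
    rfl

lemma rotHom_inv : rotHom f ≫ rotInv f = 𝟙 _ := by
  ext i m
  rfl

lemma rotInv_hom : Null (𝟙 _ - rotInv f ≫ rotHom f) := by
  refine Null.sub_of ⟨fun {i j} h => LinearMap.prod ((N.cast h.symm).comp
    ((LinearMap.snd R (M.X (i + 1)) (N.X i)).comp
      (LinearMap.snd R (N.X (i + 1)) (M.X (i + 1) × N.X i)))) 0,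
    fun {i j l j' l'} h hj hl h' a x => ?_⟩ fun {i j l} h h' x => ?_
  · refine Prod.ext ?_ (Prod.ext ?_ ?_)
    · rcases units_cases i.negOnePow with h' | h' <;> simp [h']
    · simp
    · simp
  · refine Prod.ext ?_ (Prod.ext ?_ ?_)
    · change x.1 = -(Hom.f f (i + 1) x.2.1) +
        (-(N.d (show j + 1 + 1 = i + 1 by lia) (N.cast h.symm x.2.2)) +
        N.cast h'.symm (N.cast h' x.1 + (Hom.f f l (M.cast h' x.2.1) + N.d h' x.2.2)))
      rw [f.map_cast]
      simp
      abel
    · change x.2.1 = x.2.1 + ((0 + -(M.d (show j + 1 + 1 = i + 1 by lia) 0)) + 0)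
      simp
    · change x.2.2 = 0 + ((N.cast h (N.cast h.symm x.2.2) +
        (Hom.f f i (M.cast h 0) + N.d h 0)) + 0)
      simp

end

end CDGMod

namespace CDGMod

variable {R : Type u} [CommRing R] {𝒜 : CDGAlg R}

/-! ### Shifts of the standard triangle -/

lemma isIso_of_bijective {M N : CDGMod 𝒜} (f : M ⟶ N) (h : ∀ i, Function.Bijective (f.f i)) :
    IsIso f := by
  let e (i : ℤ) := LinearEquiv.ofBijective (f.f i) (h i)
  have he (i : ℤ) (m : M.X i) : f.f i m = e i m := rfl
  refine ⟨⟨fun i => (e i).symm, fun {i j l} h a m => ?_, fun {i j} h m => ?_⟩, ?_, ?_⟩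
  · rw [LinearEquiv.coe_coe, LinearEquiv.symm_apply_eq, ← he, f.map_act, he]
    simp
  · rw [LinearEquiv.coe_coe, LinearEquiv.symm_apply_eq, ← he, f.map_d, he]
    simp
  · ext i m
    exact (e i).symm_apply_apply m
  · ext i m
    exact (e i).apply_symm_apply m

section
variable {M N : CDGMod 𝒜} (f : M ⟶ N)

/-- The comparison isomorphism `(cone f)[n] ⟶ cone (f[n])`. -/
def shiftConeHom (n : ℤ) : (cone f).shift n ⟶ cone ((shiftFun 𝒜 n).map f) where
    f := fun i => LinearMap.prod
      (n.negOnePow • (M.cast (show i + n + 1 = i + 1 + n by lia)).comp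
        (LinearMap.fst R (M.X (i + n + 1)) (N.X (i + n))))
      (LinearMap.snd R (M.X (i + n + 1)) (N.X (i + n)))
    map_act := fun {i j l} h a x => by
      refine Prod.ext ?_ ?_
      · change n.negOnePow • M.cast _ ((n * i).negOnePow • i.negOnePow • M.act _ a x.1) =
          i.negOnePow • (n * i).negOnePow • M.act _ a (n.negOnePow • M.cast _ x.1)
        rcases units_cases i.negOnePow with h' | h' <;>
        rcases units_cases n.negOnePow with h'' | h'' <;>
        rcases units_cases (n * i).negOnePow with h3 | h3 <;> simp [h', h'', h3]
      · rfl
    map_d := fun {i j} h x => by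
      refine Prod.ext ?_ ?_
      · change n.negOnePow • M.cast _ (n.negOnePow • - M.d _ x.1) =
          - (n.negOnePow • M.d _ (n.negOnePow • M.cast _ x.1))
        rcases units_cases n.negOnePow with h'' | h'' <;> simp [h'']
      · change n.negOnePow • (Hom.f f (j + n) (M.cast _ x.1) + N.d _ x.2) =
          Hom.f f (j + n) ((M.shift n).cast h (n.negOnePow • M.cast _ x.1)) +
            n.negOnePow • N.d _ x.2
        rcases units_cases n.negOnePow with h'' | h'' <;> simp [h''] <;>
          exact congrArg _ ((M.cast_cast _ _ _).symm.trans (shift_cast M n _ _).symm)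

lemma bijective_shiftConeHom (n i : ℤ) : Function.Bijective ((shiftConeHom f n).f i) := by
  refine ⟨fun x y h => ?_, fun y => ?_⟩
  · have h1 : n.negOnePow • M.cast (show i + n + 1 = i + 1 + n by lia) x.1 =
        n.negOnePow • M.cast _ y.1 :=
      congrArg (fun z : M.X (i + 1 + n) × N.X (i + n) => z.1) h
    have h2 : x.2 = y.2 :=
      congrArg (fun z : M.X (i + 1 + n) × N.X (i + n) => z.2) h
    refine Prod.ext ?_ h2
    rw [smul_left_cancel_iff] at h1
    have := congrArg (M.cast (show i + 1 + n = i + n + 1 by lia)) h1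
    simpa using this
  · refine ⟨(n.negOnePow • M.cast (show i + 1 + n = i + n + 1 by lia) y.1, y.2),
      Prod.ext ?_ rfl⟩
    change n.negOnePow • M.cast _ (n.negOnePow • M.cast _ y.1) = y.1
    rcases units_cases n.negOnePow with h'' | h'' <;> simp [h''] <;> exact M.cast_cast _ _ _

instance (n : ℤ) : IsIso (shiftConeHom f n) := isIso_of_bijective _ (bijective_shiftConeHom f n)

lemma shiftFunctorAdd_hom_app (M : CDGMod 𝒜) (a b : ℤ) :
    (shiftFunctorAdd (CDGMod 𝒜) a b).hom.app M = (M.shiftAdd a b).hom := rfl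

lemma shiftFunctorComm_f (M : CDGMod 𝒜) (a b i : ℤ) (m : ((M.shift a).shift b).X i) :
    Hom.f ((shiftFunctorComm (CDGMod 𝒜) a b).hom.app M) i m =
      M.cast (show i + b + a = i + a + b by lia) m := by
  rw [shiftFunctorComm_eq _ a b (a + b) rfl]
  have h1 := shiftFunctorAdd'_eq_shiftFunctorAdd (CDGMod 𝒜) a b
  have h2 : (shiftFunctorAdd' (CDGMod 𝒜) b a (a + b) (add_comm b a)).hom.app M =
      eqToHom (show M.shift (a + b) = M.shift (b + a) by rw [add_comm]) ≫
        (M.shiftAdd b a).hom := by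
    simp [shiftFunctorAdd', eqToHom_app]
    rfl
  rw [Iso.trans_hom, NatTrans.comp_app, Iso.symm_hom, h1, h2]
  refine (congrArg (fun z => M.cast (show i + (b + a) = i + a + b by lia) z) (eqToHom_shift_f M
    (add_comm a b) i (M.cast (show i + b + a = i + (a + b) by lia) m))).trans ?_
  exact (M.cast_cast _ _ _).trans (M.cast_cast _ _ _)

/-- The isomorphism `(cone f)[n] ≅ cone (f[n])`. -/
noncomputable def shiftConeIso (n : ℤ) : (cone f)⟦n⟧ ≅ cone (f⟦n⟧') :=
  (asIso (shiftConeHom f n) : (cone f).shift n ≅ cone ((shiftFun 𝒜 n).map f))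

/-- The shift of a standard triangle is a standard triangle. -/
noncomputable def shiftTriangleIso (n : ℤ) :
    (Triangle.shiftFunctor _ n).obj (triangle f) ≅ triangle (f⟦n⟧') := by
  refine Triangle.isoMk _ _ (Iso.refl _) (n.negOnePow • Iso.refl _) (shiftConeIso f n)
    ?_ ?_ ?_
  · change (n.negOnePow • f⟦n⟧') ≫ (n.negOnePow • 𝟙 _) = 𝟙 _ ≫ f⟦n⟧'
    rcases units_cases n.negOnePow with h | h <;> simp [h]
  · change (n.negOnePow • (coneInr f)⟦n⟧') ≫ (shiftConeIso f n).hom =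
      (n.negOnePow • 𝟙 _) ≫ coneInr (f⟦n⟧')
    have e : (coneInr f)⟦n⟧' ≫ (shiftConeIso f n).hom = coneInr (f⟦n⟧') := by
      apply hom_ext
      intro i m
      refine Prod.ext ?_ rfl
      change n.negOnePow • M.cast _ 0 = 0
      simp
    rcases units_cases n.negOnePow with h | h <;> simp [h, e]
  · change (n.negOnePow • (coneFst f)⟦n⟧' ≫ (shiftFunctorComm (CDGMod 𝒜) 1 n).hom.app M) ≫
      (𝟙 (M⟦n⟧))⟦(1 : ℤ)⟧' = (shiftConeIso f n).hom ≫ coneFst (f⟦n⟧')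
    have e : (shiftConeIso f n).hom ≫ coneFst (f⟦n⟧') =
        n.negOnePow • ((coneFst f)⟦n⟧' ≫ (shiftFunctorComm (CDGMod 𝒜) 1 n).hom.app M) := by
      have h1 (i : ℤ) (x : (cone f).X (i + n)) : Hom.f ((coneFst f)⟦n⟧' ≫
          (shiftFunctorComm (CDGMod 𝒜) 1 n).hom.app M) i x =
          M.cast (show i + n + 1 = i + 1 + n by lia) x.1 := shiftFunctorComm_f M 1 n i x.1
      have h2 (i : ℤ) (x : (cone f).X (i + n)) : Hom.f ((shiftConeIso f n).hom ≫
          coneFst (f⟦n⟧')) i x = n.negOnePow • M.cast (show i + n + 1 = i + 1 + n by lia) x.1 := rfl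
      apply hom_ext
      intro i x
      refine (h2 i x).trans ?_
      rcases units_cases n.negOnePow with h | h
      · rw [h, one_smul, one_smul]
        exact (h1 i x).symm
      · rw [h, Units.neg_smul, one_smul, Units.neg_smul, one_smul]
        exact congrArg Neg.neg (h1 i x).symm
    rw [e]
    exact (congrArg _ (CategoryTheory.Functor.map_id _ _)).trans (Category.comp_id _)

end

end CDGMod

namespace CDGMod

variable {R : Type u} [CommRing R] {𝒜 : CDGAlg R}

/-! ### Cones of compositions -/

section
variable {M N P : CDGMod 𝒜} (f : M ⟶ N) (g : N ⟶ P)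

/-- The map `cone f ⟶ cone (f ≫ g)`. -/
def coneCompα : cone f ⟶ cone (f ≫ g) where
  f i := LinearMap.prodMap LinearMap.id (g.f i)
  map_act {i j l} h a x := by
    refine Prod.ext rfl ?_
    exact g.map_act h a x.2
  map_d {i j} h x := by
    refine Prod.ext rfl ?_
    change Hom.f g j (Hom.f f j (M.cast h x.1) + N.d h x.2) =
      Hom.f g j (Hom.f f j (M.cast h x.1)) + P.d h (Hom.f g i x.2)
    rw [map_add, g.map_d]

/-- The map `cone (f ≫ g) ⟶ cone g`. -/
def coneCompβ : cone (f ≫ g) ⟶ cone g where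
  f i := LinearMap.prodMap (f.f (i + 1)) LinearMap.id
  map_act {i j l} h a x := by
    refine Prod.ext ?_ rfl
    change Hom.f f (l + 1) (i.negOnePow • M.act _ a x.1) = i.negOnePow • N.act _ a _
    rw [map_units, f.map_act]
    rfl
  map_d {i j} h x := by
    refine Prod.ext ?_ ?_
    · change Hom.f f (j + 1) (- M.d _ x.1) = - N.d _ (Hom.f f (i + 1) x.1)
      rw [map_neg, f.map_d]
    · change Hom.f g j (Hom.f f j (M.cast h x.1)) + P.d h x.2 =
        Hom.f g j (N.cast h (Hom.f f (i + 1) x.1)) + P.d h x.2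
      rw [f.map_cast]

/-- The comparison map `cone g ⟶ cone (cone f ⟶ cone (f ≫ g))`. -/
def coneCompHom : cone g ⟶ cone (coneCompα f g) where
  f i := LinearMap.prodMap (LinearMap.inr R (M.X (i + 1 + 1)) (N.X (i + 1)))
    (LinearMap.inr R (M.X (i + 1)) (P.X i))
  map_act {i j l} h a x := by
    refine Prod.ext (Prod.ext ?_ rfl) (Prod.ext ?_ rfl)
    · change 0 = i.negOnePow • i.negOnePow • M.act _ a 0
      simp
    · change 0 = i.negOnePow • M.act _ a 0
      simp
  map_d {i j} h x := by
    refine Prod.ext (Prod.ext ?_ ?_) (Prod.ext ?_ ?_)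
    · change 0 = - - M.d _ 0
      simp
    · change - N.d _ x.1 = - (Hom.f f _ (M.cast _ 0) + N.d _ x.1)
      simp
    · change 0 = ((cone f).cast h ((0 : M.X (i + 1 + 1)), x.1)).1 + - M.d _ 0
      rw [cone_cast]
      simp
    · change Hom.f g j (N.cast h x.1) + P.d h x.2 =
        Hom.f g j ((cone f).cast h ((0 : M.X (i + 1 + 1)), x.1)).2 +
          (Hom.f g j (Hom.f f j (M.cast h 0)) + P.d h x.2)
      rw [cone_cast]
      simp

/-- The comparison map `cone (cone f ⟶ cone (f ≫ g)) ⟶ cone g`. -/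
def coneCompInv : cone (coneCompα f g) ⟶ cone g where
  f i := LinearMap.prod
    ((LinearMap.snd R (M.X (i + 1 + 1)) (N.X (i + 1))).comp (LinearMap.fst R _ _) +
      ((f.f (i + 1)).comp (LinearMap.fst R (M.X (i + 1)) (P.X i))).comp (LinearMap.snd R _ _))
    ((LinearMap.snd R (M.X (i + 1)) (P.X i)).comp (LinearMap.snd R _ _))
  map_act {i j l} h a x := by
    refine Prod.ext ?_ rfl
    change i.negOnePow • N.act _ a x.1.2 + Hom.f f (l + 1) (i.negOnePow • M.act _ a x.2.1) =
      i.negOnePow • N.act _ a (x.1.2 + Hom.f f (j + 1) x.2.1)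
    rw [map_units, f.map_act, map_add, smul_add]
  map_d {i j} h x := by
    refine Prod.ext ?_ ?_
    · change - (Hom.f f (j + 1) (M.cast _ x.1.1) + N.d _ x.1.2) +
        Hom.f f (j + 1) (((cone f).cast h (x.1.1, x.1.2)).1 + - M.d _ x.2.1) =
        - N.d _ (x.1.2 + Hom.f f (i + 1) x.2.1)
      rw [cone_cast]
      simp only [map_add, map_neg, f.map_d]
      abel
    · change Hom.f g j ((cone f).cast h (x.1.1, x.1.2)).2 + (Hom.f g j (Hom.f f j (M.cast h x.2.1)) +
        P.d h x.2.2) = Hom.f g j (N.cast h (x.1.2 + Hom.f f (i + 1) x.2.1)) + P.d h x.2.2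
      rw [cone_cast, map_add, map_add, f.map_cast]
      abel

lemma coneComp_hom_inv : coneCompHom f g ≫ coneCompInv f g = 𝟙 _ := by
  apply hom_ext
  intro i x
  refine Prod.ext ?_ rfl
  change x.1 + Hom.f f (i + 1) 0 = x.1
  simp

lemma coneComp_inv_hom : Null (𝟙 _ - coneCompInv f g ≫ coneCompHom f g) := by
  refine Null.sub_of ⟨fun {i j} h => LinearMap.prod
    (LinearMap.prod ((M.cast (show i + 1 = j + 1 + 1 by lia)).comp
      ((LinearMap.fst R (M.X (i + 1)) (P.X i)).comp (LinearMap.snd R _ _))) 0) 0,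
    fun {i j l j' l'} h hj hl h' a x => ?_⟩ fun {i j l} h h' x => ?_
  · refine Prod.ext (Prod.ext ?_ ?_) (Prod.ext ?_ ?_)
    · change M.cast _ (i.negOnePow • M.act _ a x.2.1) =
        i.negOnePow • i.negOnePow • i.negOnePow • M.act _ a (M.cast _ x.2.1)
      rcases units_cases i.negOnePow with h' | h' <;> simp [h']
    · change 0 = i.negOnePow • i.negOnePow • N.act _ a 0
      simp
    · change 0 = i.negOnePow • i.negOnePow • M.act _ a 0
      simp
    · change 0 = i.negOnePow • P.act _ a 0
      simp
  · subst h
    refine Prod.ext (Prod.ext ?_ ?_) (Prod.ext ?_ ?_)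
    · change x.1.1 = 0 + (- - M.d _ (M.cast (rfl : j + 1 + 1 = j + 1 + 1) x.2.1) +
        M.cast _ (((cone f).cast h' (x.1.1, x.1.2)).1 + - M.d _ x.2.1))
      rw [cone_cast]
      simp
    · change x.1.2 = (x.1.2 + Hom.f f (j + 1 + 1) x.2.1) +
        (- (Hom.f f _ (M.cast (rfl : j + 1 + 1 = j + 1 + 1) (M.cast (rfl : j + 1 + 1 = j + 1 + 1) x.2.1)) + N.d (rfl : j + 1 + 1 = j + 1 + 1) 0) + 0)
      simp
    · change x.2.1 = 0 + ((((cone f).cast rfl (M.cast rfl x.2.1, 0)).1 + - M.d _ 0) + 0)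
      rw [cone_cast]
      simp
    · change x.2.2 = x.2.2 + ((Hom.f g _ ((cone f).cast rfl (M.cast rfl x.2.1, 0)).2 +
        (Hom.f g _ (Hom.f f _ (M.cast _ 0)) + P.d _ 0)) + 0)
      rw [cone_cast]
      simp

lemma coneInr_coneCompInv : coneInr (coneCompα f g) ≫ coneCompInv f g = coneCompβ f g := by
  apply hom_ext
  intro i x
  refine Prod.ext ?_ rfl
  change 0 + Hom.f f (i + 1) x.1 = Hom.f f (i + 1) x.1
  simp

lemma coneCompHom_coneFst : coneCompHom f g ≫ coneFst (coneCompα f g) =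
    coneFst g ≫ (coneInr f)⟦(1 : ℤ)⟧' := rfl

lemma coneInr_coneCompα : coneInr f ≫ coneCompα f g = g ≫ coneInr (f ≫ g) := rfl

lemma coneCompα_coneFst : coneCompα f g ≫ coneFst (f ≫ g) = coneFst f := rfl

lemma coneInr_coneCompβ : coneInr (f ≫ g) ≫ coneCompβ f g = coneInr g := by
  apply hom_ext
  intro i x
  refine Prod.ext ?_ rfl
  exact map_zero (f.f (i + 1))

lemma coneCompβ_coneFst : coneCompβ f g ≫ coneFst g = coneFst (f ≫ g) ≫ f⟦(1 : ℤ)⟧' := rfl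

end

end CDGMod

namespace Hot

open CDGMod

variable {R : Type u} [CommRing R] {𝒜 : CDGAlg R}

/-- The image of the standard triangle `M ⟶ N ⟶ cone f ⟶ M[1]` in the homotopy category. -/
noncomputable abbrev triangle {M N : CDGMod 𝒜} (f : M ⟶ N) : Triangle (Hot 𝒜) :=
  Triangle.mk ((quot 𝒜).map f) ((quot 𝒜).map (coneInr f))
    ((quot 𝒜).map (coneFst f) ≫ ((quot 𝒜).commShiftIso (1 : ℤ)).hom.app M)

/-- An isomorphism of triangles with the same first morphism. -/
def isoOfThird {C : Type*} [Category C] [HasShift C ℤ] {X Y Z Z' : C} {f : X ⟶ Y} {g : Y ⟶ Z}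
    {h : Z ⟶ X⟦(1 : ℤ)⟧} {g' : Y ⟶ Z'} {h' : Z' ⟶ X⟦(1 : ℤ)⟧} (e : Z ≅ Z') (h₂ : g ≫ e.hom = g')
    (h₃ : e.hom ≫ h' = h) : Triangle.mk f g h ≅ Triangle.mk f g' h' :=
  Triangle.isoMk _ _ (Iso.refl X) (Iso.refl Y) e
    ((Category.comp_id _).trans (Category.id_comp _).symm)
    (h₂.trans (Category.id_comp _).symm)
    (((congrArg (h ≫ ·) (CategoryTheory.Functor.map_id _ _)).trans (Category.comp_id _)).trans
      h₃.symm)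

lemma exists_quot_obj (X : Hot 𝒜) : ∃ M, X = (quot 𝒜).obj M := ⟨X.as, rfl⟩

/-- Distinguished triangles: those isomorphic to the standard triangle of some morphism. -/
def distinguished (𝒜 : CDGAlg R) : Set (Triangle (Hot 𝒜)) :=
  {T | ∃ (M N : CDGMod 𝒜) (f : M ⟶ N), Nonempty (T ≅ triangle f)}

lemma isomorphic_distinguished (T₁ : Triangle (Hot 𝒜)) (hT₁ : T₁ ∈ distinguished 𝒜)
    (T₂ : Triangle (Hot 𝒜)) (e : T₂ ≅ T₁) : T₂ ∈ distinguished 𝒜 := by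
  obtain ⟨X, Y, f, ⟨e'⟩⟩ := hT₁
  exact ⟨X, Y, f, ⟨e ≪≫ e'⟩⟩

/-- Homotopy equivalences become isomorphisms. -/
noncomputable def isoOfHtpy {M N : CDGMod 𝒜} (f : M ⟶ N) (g : N ⟶ M) (h : f ≫ g = 𝟙 _)
    (h' : Null (𝟙 _ - g ≫ f)) : (quot 𝒜).obj M ≅ (quot 𝒜).obj N where
  hom := (quot 𝒜).map f
  inv := (quot 𝒜).map g
  hom_inv_id := by rw [← Functor.map_comp, h, CategoryTheory.Functor.map_id]
  inv_hom_id := by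
    rw [← Functor.map_comp, ← CategoryTheory.Functor.map_id]
    exact ((quot_map_eq_iff _ _).2 h').symm

lemma contractible_distinguished (X : Hot 𝒜) :
    Pretriangulated.contractibleTriangle X ∈ distinguished 𝒜 := by
  obtain ⟨M, rfl⟩ := exists_quot_obj X
  refine ⟨M, M, 𝟙 M, ⟨?_⟩⟩
  have h := (isZero_quot_iff _).2 (null_id_cone_id M)
  exact Triangle.isoMk _ _ (Iso.refl _) (Iso.refl _) h.isoZero.symm
    (by
      change 𝟙 _ ≫ 𝟙 _ = 𝟙 _ ≫ (quot 𝒜).map (𝟙 M)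
      rw [CategoryTheory.Functor.map_id]) (h.eq_of_tgt _ _)
    ((isZero_zero _).eq_of_src _ _)

lemma distinguished_cocone_triangle {X Y : Hot 𝒜} (f : X ⟶ Y) :
    ∃ (Z : Hot 𝒜) (g : Y ⟶ Z) (h : Z ⟶ X⟦(1 : ℤ)⟧), Triangle.mk f g h ∈ distinguished 𝒜 := by
  obtain ⟨M, rfl⟩ := exists_quot_obj X
  obtain ⟨N, rfl⟩ := exists_quot_obj Y
  obtain ⟨f, rfl⟩ := (quot 𝒜).map_surjective f
  exact ⟨_, _, _, ⟨_, _, f, ⟨Iso.refl _⟩⟩⟩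

/-- `M[1]` and the cone of the inclusion `N ⟶ cone f` are homotopy equivalent. -/
noncomputable def rotHtpyIso {M N : CDGMod 𝒜} (f : M ⟶ N) :
    (quot 𝒜).obj (M⟦(1 : ℤ)⟧) ≅ (quot 𝒜).obj (cone (coneInr f)) :=
  isoOfHtpy (M := M⟦(1 : ℤ)⟧) (rotHom f) (rotInv f) (rotHom_inv f) (rotInv_hom f)

lemma rotHtpyIso_comm₂ {M N : CDGMod 𝒜} (f : M ⟶ N) :
    (quot 𝒜).map (coneFst f) ≫ (rotHtpyIso f).hom = (quot 𝒜).map (coneInr (coneInr f)) := by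
  symm
  rw [← Iso.comp_inv_eq]
  exact ((quot 𝒜).map_comp (coneInr (coneInr f)) _).symm

lemma rotHtpyIso_comm₃ {M N : CDGMod 𝒜} (f : M ⟶ N) :
    (rotHtpyIso f).hom ≫ (quot 𝒜).map (coneFst (coneInr f)) =
      - (quot 𝒜).map (f⟦(1 : ℤ)⟧') := by
  rw [← Functor.map_neg]
  exact ((quot 𝒜).map_comp _ _).symm

/-- The isomorphism from the shift of `M` in the homotopy category to the cone of the inclusion
`N ⟶ cone f`. -/
noncomputable def rotShiftIso {M N : CDGMod 𝒜} (f : M ⟶ N) :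
    ((quot 𝒜).obj M)⟦(1 : ℤ)⟧ ≅ (quot 𝒜).obj (cone (coneInr f)) :=
  ((quot 𝒜).commShiftIso (1 : ℤ)).symm.app M ≪≫ rotHtpyIso f

lemma rotShiftIso_comm₂ {M N : CDGMod 𝒜} (f : M ⟶ N) :
    ((quot 𝒜).map (coneFst f) ≫ ((quot 𝒜).commShiftIso (1 : ℤ)).hom.app M) ≫
      (rotShiftIso f).hom = (quot 𝒜).map (coneInr (coneInr f)) := by
  simp [rotShiftIso, rotHtpyIso_comm₂]

lemma rotShiftIso_comm₃ {M N : CDGMod 𝒜} (f : M ⟶ N) :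
    (rotShiftIso f).hom ≫ (quot 𝒜).map (coneFst (coneInr f)) ≫
      ((quot 𝒜).commShiftIso (1 : ℤ)).hom.app N = - ((quot 𝒜).map f)⟦(1 : ℤ)⟧' := by
  have := rotHtpyIso_comm₃ f
  simp [rotShiftIso, reassoc_of% this]

/-- The rotation of a standard triangle. -/
noncomputable def rotateIso {M N : CDGMod 𝒜} (f : M ⟶ N) :
    (triangle f).rotate ≅ triangle (coneInr f) :=
  isoOfThird (rotShiftIso f) (rotShiftIso_comm₂ f) (rotShiftIso_comm₃ f)

lemma mapTriangle_obj {M N : CDGMod 𝒜} (f : M ⟶ N) :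
    (quot 𝒜).mapTriangle.obj (CDGMod.triangle f) = triangle f := rfl

/-- The shift of a standard triangle. -/
noncomputable def shiftIso {M N : CDGMod 𝒜} (f : M ⟶ N) (n : ℤ) :
    (Triangle.shiftFunctor _ n).obj ((quot 𝒜).mapTriangle.obj (CDGMod.triangle f)) ≅
      (quot 𝒜).mapTriangle.obj (CDGMod.triangle (f⟦n⟧')) :=
  ((quot 𝒜).mapTriangle.commShiftIso n).symm.app (CDGMod.triangle f) ≪≫
    (quot 𝒜).mapTriangle.mapIso (shiftTriangleIso f n)

lemma rotate_distinguished' (T : Triangle (Hot 𝒜)) (hT : T ∈ distinguished 𝒜) :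
    T.rotate ∈ distinguished 𝒜 := by
  obtain ⟨K, L, φ, ⟨e⟩⟩ := hT
  exact ⟨_, _, _, ⟨(rotate _).mapIso e ≪≫ rotateIso φ⟩⟩

lemma shift_distinguished (T : Triangle (Hot 𝒜)) (hT : T ∈ distinguished 𝒜) (n : ℤ) :
    (Triangle.shiftFunctor _ n).obj T ∈ distinguished 𝒜 := by
  obtain ⟨K, L, φ, ⟨e⟩⟩ := hT
  rw [← mapTriangle_obj] at e
  refine ⟨_, _, φ⟦n⟧', ?_⟩
  rw [← mapTriangle_obj]
  exact ⟨Functor.mapIso _ e ≪≫ shiftIso φ n⟩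

lemma invRotate_distinguished (T : Triangle (Hot 𝒜)) (hT : T ∈ distinguished 𝒜) :
    T.invRotate ∈ distinguished 𝒜 :=
  isomorphic_distinguished _ (shift_distinguished _ (rotate_distinguished' _
    (rotate_distinguished' _ hT)) _) _ ((invRotateIsoRotateRotateShiftFunctorNegOne _).app T)

lemma rotate_distinguished (T : Triangle (Hot 𝒜)) :
    T ∈ distinguished 𝒜 ↔ T.rotate ∈ distinguished 𝒜 :=
  ⟨rotate_distinguished' T, fun hT => isomorphic_distinguished _
    (invRotate_distinguished T.rotate hT) _ ((triangleRotation _).unitIso.app T)⟩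

lemma complete_of_iso {C : Type*} [Category C] [HasShift C ℤ] {T₁ T₂ S₁ S₂ : Triangle C}
    (e₁ : T₁ ≅ S₁) (e₂ : T₂ ≅ S₂)
    (H : ∀ (a : S₁.obj₁ ⟶ S₂.obj₁) (b : S₁.obj₂ ⟶ S₂.obj₂), S₁.mor₁ ≫ b = a ≫ S₂.mor₁ →
      ∃ c : S₁.obj₃ ⟶ S₂.obj₃, S₁.mor₂ ≫ c = b ≫ S₂.mor₂ ∧
        S₁.mor₃ ≫ a⟦(1 : ℤ)⟧' = c ≫ S₂.mor₃)
    (a : T₁.obj₁ ⟶ T₂.obj₁) (b : T₁.obj₂ ⟶ T₂.obj₂) (fac : T₁.mor₁ ≫ b = a ≫ T₂.mor₁) :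
    ∃ (c : T₁.obj₃ ⟶ T₂.obj₃), T₁.mor₂ ≫ c = b ≫ T₂.mor₂ ∧
      T₁.mor₃ ≫ a⟦(1 : ℤ)⟧' = c ≫ T₂.mor₃ := by
  have i₁ := e₁.inv.comm₁
  have i₂ := e₂.hom.comm₁
  obtain ⟨c, k₂, k₃⟩ := H (e₁.inv.hom₁ ≫ a ≫ e₂.hom.hom₁) (e₁.inv.hom₂ ≫ b ≫ e₂.hom.hom₂) (by
    rw [reassoc_of% i₁, reassoc_of% fac, i₂]
    simp)
  have j₂ := e₁.hom.comm₂
  have j₃ := e₁.hom.comm₃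
  have l₂ := e₂.inv.comm₂
  have l₃ := e₂.inv.comm₃
  refine ⟨e₁.hom.hom₃ ≫ c ≫ e₂.inv.hom₃, ?_, ?_⟩
  · rw [reassoc_of% j₂, reassoc_of% k₂, l₂]
    simp
  · rw [Category.assoc, Category.assoc, ← l₃, ← reassoc_of% k₃, ← reassoc_of% j₃]
    simp only [← Functor.map_comp, Category.assoc]
    simp

lemma complete_distinguished (T₁ T₂ : Triangle (Hot 𝒜))
    (hT₁ : T₁ ∈ distinguished 𝒜) (hT₂ : T₂ ∈ distinguished 𝒜)
    (a : T₁.obj₁ ⟶ T₂.obj₁) (b : T₁.obj₂ ⟶ T₂.obj₂) (fac : T₁.mor₁ ≫ b = a ≫ T₂.mor₁) :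
    ∃ (c : T₁.obj₃ ⟶ T₂.obj₃), T₁.mor₂ ≫ c = b ≫ T₂.mor₂ ∧
      T₁.mor₃ ≫ a⟦(1 : ℤ)⟧' = c ≫ T₂.mor₃ := by
  obtain ⟨K₁, L₁, φ₁, ⟨e₁⟩⟩ := hT₁
  obtain ⟨K₂, L₂, φ₂, ⟨e₂⟩⟩ := hT₂
  refine complete_of_iso e₁ e₂ (fun a b h => ?_) a b fac
  change (quot 𝒜).obj K₁ ⟶ (quot 𝒜).obj K₂ at a
  change (quot 𝒜).obj L₁ ⟶ (quot 𝒜).obj L₂ at b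
  obtain ⟨a, rfl⟩ := (quot 𝒜).map_surjective a
  obtain ⟨b, rfl⟩ := (quot 𝒜).map_surjective b
  replace h := (quot_map_eq_iff _ _).1
    (((quot 𝒜).map_comp _ _).trans (Eq.trans h ((quot 𝒜).map_comp _ _).symm))
  obtain ⟨c, hc₂, hc₃⟩ := exists_cone_map φ₁ φ₂ a b h
  refine ⟨(quot 𝒜).map c, ?_, ?_⟩
  · exact ((quot 𝒜).map_comp _ _).symm.trans ((congrArg (quot 𝒜).map hc₂).trans
      ((quot 𝒜).map_comp _ _))
  · have := congrArg (quot 𝒜).map hc₃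
    rw [Functor.map_comp, Functor.map_comp] at this
    change ((quot 𝒜).map (coneFst φ₁) ≫ ((quot 𝒜).commShiftIso (1 : ℤ)).hom.app K₁) ≫
      ((quot 𝒜).map a)⟦(1 : ℤ)⟧' = (quot 𝒜).map c ≫ (quot 𝒜).map (coneFst φ₂) ≫
        ((quot 𝒜).commShiftIso (1 : ℤ)).hom.app K₂
    rw [← reassoc_of% this]
    simp

noncomputable instance : Pretriangulated (Hot 𝒜) where
  distinguishedTriangles := distinguished 𝒜
  isomorphic_distinguished := isomorphic_distinguished
  contractible_distinguished := contractible_distinguished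
  distinguished_cocone_triangle := distinguished_cocone_triangle
  rotate_distinguished_triangle := rotate_distinguished
  complete_distinguished_triangle_morphism := complete_distinguished

lemma triangle_distinguished {M N : CDGMod 𝒜} (f : M ⟶ N) :
    triangle f ∈ distTriang (Hot 𝒜) := ⟨_, _, f, ⟨Iso.refl _⟩⟩

/-- `cone g` and the cone of `cone f ⟶ cone (f ≫ g)` are homotopy equivalent. -/
noncomputable def coneCompIso {M N P : CDGMod 𝒜} (f : M ⟶ N) (g : N ⟶ P) :
    (quot 𝒜).obj (cone g) ≅ (quot 𝒜).obj (cone (coneCompα f g)) :=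
  isoOfHtpy (coneCompHom f g) (coneCompInv f g) (coneComp_hom_inv f g) (coneComp_inv_hom f g)

lemma coneCompIso_comm₂ {M N P : CDGMod 𝒜} (f : M ⟶ N) (g : N ⟶ P) :
    (quot 𝒜).map (coneCompβ f g) ≫ (coneCompIso f g).hom =
      (quot 𝒜).map (coneInr (coneCompα f g)) := by
  symm
  rw [← Iso.comp_inv_eq]
  exact ((quot 𝒜).map_comp _ _).symm.trans (congrArg (quot 𝒜).map (coneInr_coneCompInv f g))

lemma coneCompIso_comm₃ {M N P : CDGMod 𝒜} (f : M ⟶ N) (g : N ⟶ P) :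
    (coneCompIso f g).hom ≫ (quot 𝒜).map (coneFst (coneCompα f g)) =
      (quot 𝒜).map (coneFst g) ≫ (quot 𝒜).map ((coneInr f)⟦(1 : ℤ)⟧') :=
  ((quot 𝒜).map_comp _ _).symm.trans ((congrArg (quot 𝒜).map (coneCompHom_coneFst f g)).trans
    ((quot 𝒜).map_comp _ _))

lemma coneComp_distinguished {M N P : CDGMod 𝒜} (f : M ⟶ N) (g : N ⟶ P) :
    Triangle.mk ((quot 𝒜).map (coneCompα f g)) ((quot 𝒜).map (coneCompβ f g))
      (((quot 𝒜).map (coneFst g) ≫ ((quot 𝒜).commShiftIso (1 : ℤ)).hom.app N) ≫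
        ((quot 𝒜).map (coneInr f))⟦(1 : ℤ)⟧') ∈ distTriang (Hot 𝒜) := by
  refine ⟨_, _, coneCompα f g, ⟨isoOfThird (coneCompIso f g) (coneCompIso_comm₂ f g) ?_⟩⟩
  have := coneCompIso_comm₃ f g
  rw [reassoc_of% this]
  simp

noncomputable instance : IsTriangulated (Hot 𝒜) :=
  IsTriangulated.mk' (by
    intro X Y Z f g
    obtain ⟨M, rfl⟩ := exists_quot_obj X
    obtain ⟨N, rfl⟩ := exists_quot_obj Y
    obtain ⟨P, rfl⟩ := exists_quot_obj Z
    obtain ⟨f, rfl⟩ := (quot 𝒜).map_surjective f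
    obtain ⟨g, rfl⟩ := (quot 𝒜).map_surjective g
    have h := triangle_distinguished (f ≫ g)
    rw [triangle, Functor.map_comp] at h
    refine ⟨_, _, _, _, _, _, _, _, Iso.refl _, Iso.refl _, Iso.refl _, by simp, by simp,
        _, _, triangle_distinguished f, _, _, triangle_distinguished g, _, _, h, ⟨?_⟩⟩
    have e₁ := congrArg (quot 𝒜).map (coneInr_coneCompα f g)
    have e₂ := congrArg (quot 𝒜).map (coneCompα_coneFst f g)
    have e₃ := congrArg (quot 𝒜).map (coneInr_coneCompβ f g)
    have e₄ := congrArg (quot 𝒜).map (coneCompβ_coneFst f g)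
    rw [Functor.map_comp] at e₁ e₂ e₃ e₄
    rw [Functor.map_comp] at e₁ e₄
    refine Triangulated.Octahedron.mk ((quot 𝒜).map (coneCompα f g))
      ((quot 𝒜).map (coneCompβ f g)) ?_ ?_ ?_ ?_ ?_
    · exact e₁
    · exact (reassoc_of% e₂) _
    · exact e₃
    · change ((quot 𝒜).map (coneFst (f ≫ g)) ≫ ((quot 𝒜).commShiftIso (1 : ℤ)).hom.app M) ≫
        ((quot 𝒜).map f)⟦(1 : ℤ)⟧' = (quot 𝒜).map (coneCompβ f g) ≫ (quot 𝒜).map (coneFst g) ≫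
          ((quot 𝒜).commShiftIso (1 : ℤ)).hom.app N
      rw [reassoc_of% e₄]
      simp
    · exact coneComp_distinguished f g)

end Hot

/-- A dg algebra over `R`: a cdg algebra with zero curvature. -/
structure DGAlg (R : Type u) [CommRing R] extends CDGAlg R where
  curv_eq_zero : curv = 0

/-- A formal cdg deformation of `A`: a `t`-torsion-free cdg algebra `alg` over `k⟦t⟧`, with an
identification of its reduction modulo `t` with `A`, that is, a surjective map of cdg algebras
`proj : alg ⟶ A`, semilinear over `k⟦t⟧ → k`, whose kernel is `t • alg`.  In particular this
includes all cdg algebra structures on `A⟦t⟧` or on `A ⊗ k⟦t⟧` that reduce to `A` modulo `t`. -/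
structure FormalDeformation {k : Type u} [CommRing k] (A : DGAlg k) where
  alg : CDGAlg k⟦X⟧
  proj : ∀ i : ℤ, alg.X i →ₛₗ[(PowerSeries.constantCoeff : k⟦X⟧ →+* k)] A.X i
  proj_surjective : ∀ i, Function.Surjective (proj i)
  proj_eq_zero_iff : ∀ (i : ℤ) (a : alg.X i),
    proj i a = 0 ↔ ∃ b : alg.X i, a = (PowerSeries.X : k⟦X⟧) • b
  torsionFree : ∀ (i : ℤ) (a : alg.X i), (PowerSeries.X : k⟦X⟧) • a = 0 → a = 0
  proj_one : proj 0 alg.one = A.one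
  proj_mul : ∀ {i j l : ℤ} (h : i + j = l) (a : alg.X i) (b : alg.X j),
    proj l (alg.mul h a b) = A.mul h (proj i a) (proj j b)
  proj_d : ∀ {i j : ℤ} (h : i + 1 = j) (a : alg.X i), proj j (alg.d h a) = A.d h (proj i a)
  proj_curv : proj 2 alg.curv = A.curv

namespace CDGMod

variable {k : Type u} [CommRing k] {𝒜 : CDGAlg k⟦X⟧}

/-! ### Torsion modules -/

/-- A module is torsion if every element is annihilated by a power of `t`. -/
def IsTorsion (M : CDGMod 𝒜) : Prop :=
  ∀ (i : ℤ) (m : M.X i), ∃ n : ℕ, (PowerSeries.X ^ n : k⟦X⟧) • m = 0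

lemma IsTorsion.shift {M : CDGMod 𝒜} (hM : M.IsTorsion) (n : ℤ) : (M.shift n).IsTorsion :=
  fun i m => hM (i + n) m

lemma IsTorsion.cone {M N : CDGMod 𝒜} (hM : M.IsTorsion) (hN : N.IsTorsion) (f : M ⟶ N) :
    (cone f).IsTorsion := fun i x => by
  obtain ⟨a, ha⟩ := hM (i + 1) x.1
  obtain ⟨b, hb⟩ := hN i x.2
  refine ⟨a + b, Prod.ext ?_ ?_⟩
  · change (PowerSeries.X ^ (a + b) : k⟦X⟧) • x.1 = 0
    rw [pow_add, mul_comm, mul_smul, ha, smul_zero]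
  · change (PowerSeries.X ^ (a + b) : k⟦X⟧) • x.2 = 0
    rw [pow_add, mul_smul, hb, smul_zero]

/-! ### The kernel filtration -/

/-- The component of degree `j` of `Ker t ^ i`. -/
noncomputable abbrev kerT (M : CDGMod 𝒜) (i : ℕ) (j : ℤ) : Submodule k⟦X⟧ (M.X j) :=
  LinearMap.ker (LinearMap.lsmul k⟦X⟧ (M.X j) (PowerSeries.X ^ i))

/-- The component of degree `j` of `Grᵢ(M) = Ker t ^ (i + 1) / Ker t ^ i`, the `i`-th graded
piece of the kernel filtration. -/
abbrev GrK (M : CDGMod 𝒜) (i : ℕ) (j : ℤ) : Type u :=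
  M.kerT (i + 1) j ⧸ (M.kerT i j).submoduleOf (M.kerT (i + 1) j)

/-- The restriction of the predifferential to `Ker t ^ i`. -/
noncomputable def kerTD (M : CDGMod 𝒜) (i : ℕ) {j l : ℤ} (h : j + 1 = l) : M.kerT i j →ₗ[k⟦X⟧] M.kerT i l :=
  (M.d h).restrict fun m hm => by
    simp only [LinearMap.mem_ker, LinearMap.lsmul_apply] at hm ⊢
    rw [← map_smul, hm, map_zero]

/-- The differential induced on `Grᵢ(M)`. -/
noncomputable def grKD (M : CDGMod 𝒜) (i : ℕ) {j l : ℤ} (h : j + 1 = l) : M.GrK i j →ₗ[k⟦X⟧] M.GrK i l :=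
  Submodule.mapQ _ _ (M.kerTD (i + 1) h) fun m hm => by
    simp only [Submodule.submoduleOf, Submodule.mem_comap, LinearMap.mem_ker,
      LinearMap.lsmul_apply, Submodule.subtype_apply] at hm ⊢
    change _ • M.d h m.1 = 0
    rw [← map_smul, hm, map_zero]

/-- A module is `t`-acyclic if the associated graded of its kernel filtration is acyclic. -/
def IsTAcyclic (M : CDGMod 𝒜) : Prop :=
  ∀ (i : ℕ) {j₀ j j₁ : ℤ} (h₀ : j₀ + 1 = j) (h₁ : j + 1 = j₁),
    Function.Exact (M.grKD i h₀) (M.grKD i h₁)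

lemma isTAcyclic_iff (hc : ∃ b : 𝒜.X 2, 𝒜.curv = (PowerSeries.X : k⟦X⟧) • b) (M : CDGMod 𝒜) :
    M.IsTAcyclic ↔ ∀ (i : ℕ) {j₀ j j₁ : ℤ} (h₀ : j₀ + 1 = j) (h₁ : j + 1 = j₁) (m : M.X j),
      (PowerSeries.X ^ (i + 1) : k⟦X⟧) • m = 0 → (PowerSeries.X ^ i : k⟦X⟧) • M.d h₁ m = 0 →
      ∃ m' : M.X j₀, (PowerSeries.X ^ (i + 1) : k⟦X⟧) • m' = 0 ∧ (PowerSeries.X ^ i : k⟦X⟧) • (m - M.d h₀ m') = 0 := by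
  obtain ⟨b, hb⟩ := hc
  have h0 (i : ℕ) {j : ℤ} (x : M.kerT (i + 1) j) :
      (Submodule.Quotient.mk x : M.GrK i j) = 0 ↔ (PowerSeries.X ^ i : k⟦X⟧) • x.1 = 0 := by
    rw [Submodule.Quotient.mk_eq_zero]
    rfl
  constructor
  · intro H i j₀ j j₁ h₀ h₁ m hm hd
    obtain ⟨y, hy⟩ := (H i h₀ h₁ (Submodule.Quotient.mk ⟨m, hm⟩)).1 ((h0 i _).2 hd)
    obtain ⟨m', rfl⟩ := Submodule.Quotient.mk_surjective _ y
    refine ⟨m'.1, m'.2, ?_⟩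
    have := (h0 i _).1 ((Submodule.Quotient.mk_sub _).trans (sub_eq_zero.2 hy.symm))
    exact this
  · intro H i j₀ j j₁ h₀ h₁ y
    obtain ⟨m, rfl⟩ := Submodule.Quotient.mk_surjective _ y
    constructor
    · intro hy
      obtain ⟨m', h1, h2⟩ := H i h₀ h₁ m.1 m.2 ((h0 i _).1 hy)
      refine ⟨Submodule.Quotient.mk ⟨m', h1⟩, ?_⟩
      refine (sub_eq_zero.1 ((Submodule.Quotient.mk_sub _).symm.trans ((h0 i _).2 ?_))).symm
      exact h2
    · rintro ⟨z, hz⟩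
      obtain ⟨m', rfl⟩ := Submodule.Quotient.mk_surjective _ z
      rw [← hz]
      refine (h0 i _).2 ?_
      change _ • M.d h₁ (M.d h₀ m'.1) = 0
      have hm' : (PowerSeries.X ^ (i + 1) : k⟦X⟧) • m'.1 = 0 := m'.2
      rw [M.d_d h₀ h₁ (by lia), hb, map_smul, LinearMap.smul_apply, smul_smul, ← pow_succ,
        ← map_smul, hm', map_zero]

lemma IsTAcyclic.of_htpy (hc : ∃ b : 𝒜.X 2, 𝒜.curv = (PowerSeries.X : k⟦X⟧) • b)
    {M N : CDGMod 𝒜} (hM : M.IsTAcyclic) (g : N ⟶ M) (f : M ⟶ N)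
    (h : Null (𝟙 N - g ≫ f)) : N.IsTAcyclic := by
  rw [isTAcyclic_iff hc] at hM ⊢
  obtain ⟨σ, hσ⟩ := h
  intro i j₀ j j₁ h₀ h₁ n hn hd
  obtain ⟨m', h1, h2⟩ := hM i h₀ h₁ (g.f j n) (by rw [← map_smul, hn, map_zero])
    (by rw [← g.map_d, ← map_smul, hd, map_zero])
  have e := hσ h₀ h₁ n
  rw [sub_f, id_f, comp_f, sub_eq_iff_eq_add] at e
  refine ⟨f.f j₀ m' + σ.s h₀ n, ?_, ?_⟩
  · rw [smul_add, ← map_smul, ← map_smul, h1, hn, map_zero, map_zero, add_zero]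
  · have h3 : n - N.d h₀ (f.f j₀ m' + σ.s h₀ n) =
        f.f j (g.f j n - M.d h₀ m') + σ.s h₁ (N.d h₁ n) := by
      nth_rw 1 [e]
      rw [map_add, map_sub, f.map_d]
      abel
    rw [h3, smul_add, ← map_smul, ← map_smul, h2, hd, map_zero, map_zero, add_zero]

lemma IsTAcyclic.shift (hc : ∃ b : 𝒜.X 2, 𝒜.curv = (PowerSeries.X : k⟦X⟧) • b)
    {M : CDGMod 𝒜} (hM : M.IsTAcyclic) (n : ℤ) :
    (M.shift n).IsTAcyclic := by
  rw [isTAcyclic_iff hc] at hM ⊢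
  intro i j₀ j j₁ h₀ h₁ m hm hd
  change (PowerSeries.X ^ i : k⟦X⟧) • n.negOnePow • M.d _ m = 0 at hd
  obtain ⟨m', h1, h2⟩ := hM i (show j₀ + n + 1 = j + n by lia) (show j + n + 1 = j₁ + n by lia) m
    hm (by rcases units_cases n.negOnePow with h | h <;> simpa [h] using hd)
  refine ⟨n.negOnePow • m', ?_, ?_⟩
  · change (PowerSeries.X ^ (i + 1) : k⟦X⟧) • n.negOnePow • m' = 0
    rcases units_cases n.negOnePow with h | h <;> simpa [h] using h1
  · change (PowerSeries.X ^ i : k⟦X⟧) • (m - n.negOnePow • M.d _ (n.negOnePow • m')) = 0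
    rcases units_cases n.negOnePow with h | h <;> simpa [h] using h2

lemma IsTAcyclic.cone (hc : ∃ b : 𝒜.X 2, 𝒜.curv = (PowerSeries.X : k⟦X⟧) • b)
    {M N : CDGMod 𝒜} (hM : M.IsTAcyclic) (hN : N.IsTAcyclic) (f : M ⟶ N) :
    (cone f).IsTAcyclic := by
  rw [isTAcyclic_iff hc] at hM hN ⊢
  rintro i j₀ j j₁ h₀ h₁ ⟨m, n⟩ hx hd
  subst h₀
  have hm : (PowerSeries.X ^ (i + 1) : k⟦X⟧) • m = 0 := congrArg Prod.fst hx
  have hn : (PowerSeries.X ^ (i + 1) : k⟦X⟧) • n = 0 := congrArg Prod.snd hx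
  have hdm : (PowerSeries.X ^ i : k⟦X⟧) • - M.d _ m = 0 := congrArg Prod.fst hd
  have hdn : (PowerSeries.X ^ i : k⟦X⟧) • (Hom.f f j₁ (M.cast h₁ m) + N.d h₁ n) = 0 := congrArg Prod.snd hd
  rw [smul_neg, neg_eq_zero] at hdm
  obtain ⟨m₁, h1, h2⟩ := hM i (show j₀ + 1 + 1 = j₀ + 1 + 1 by rfl) _ m hm hdm
  obtain ⟨n₁, h3, h4⟩ := hN i rfl h₁ (n + f.f (j₀ + 1) m₁)
    (by rw [smul_add, ← map_smul, hn, h1, map_zero, add_zero]) (by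
      have e : N.d h₁ (n + f.f (j₀ + 1) m₁) = (Hom.f f j₁ (M.cast h₁ m) + N.d h₁ n) -
          f.f j₁ (M.cast h₁ (m - M.d rfl m₁)) := by
        rw [map_sub, map_sub, M.cast_d, map_add, f.map_d]
        abel
      rw [e, smul_sub, hdn, ← map_smul, ← map_smul, h2, map_zero, map_zero, sub_zero])
  refine ⟨(-m₁, n₁), Prod.ext ?_ ?_, Prod.ext ?_ ?_⟩
  · change (PowerSeries.X ^ (i + 1) : k⟦X⟧) • -m₁ = 0
    rw [smul_neg, h1, neg_zero]
  · exact h3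
  · change (PowerSeries.X ^ i : k⟦X⟧) • (m - - M.d _ (-m₁)) = 0
    rwa [map_neg, neg_neg]
  · change (PowerSeries.X ^ i : k⟦X⟧) • (n - (Hom.f f _ (M.cast _ (-m₁)) + N.d _ n₁)) = 0
    have e : n - (Hom.f f (j₀ + 1) (M.cast rfl (-m₁)) + N.d rfl n₁) =
      n + f.f (j₀ + 1) m₁ - N.d rfl n₁ := by
      rw [cast_rfl, map_neg]
      abel
    rwa [e]

end CDGMod

namespace Hot

open CDGMod

variable {k : Type u} [CommRing k]

/-- The torsion modules, as objects of the homotopy category. -/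
def torsion (𝒜 : CDGAlg k⟦X⟧) : ObjectProperty (Hot 𝒜) := fun M => CDGMod.IsTorsion M.as

variable {𝒜 : CDGAlg k⟦X⟧}

lemma torsion_quot_iff (M : CDGMod 𝒜) : torsion 𝒜 ((quot 𝒜).obj M) ↔ M.IsTorsion := Iff.rfl

instance : (torsion 𝒜).IsStableUnderShift ℤ where
  isStableUnderShiftBy n := ⟨fun M hM => by
    obtain ⟨M, rfl⟩ := exists_quot_obj M
    rw [ObjectProperty.prop_shift_iff, shift_quot_obj, torsion_quot_iff]
    exact IsTorsion.shift hM n⟩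

lemma isTriangulatedClosed₃_of_cone (P : ObjectProperty (Hot 𝒜))
    (hP : ∀ {M N : CDGMod 𝒜} (f : M ⟶ N), P ((quot 𝒜).obj M) → P ((quot 𝒜).obj N) →
      P ((quot 𝒜).obj (CDGMod.cone f))) : P.IsTriangulatedClosed₃ where
  ext₃' T hT h₁ h₂ := by
    obtain ⟨M, hM⟩ := exists_quot_obj T.obj₁
    obtain ⟨N, hN⟩ := exists_quot_obj T.obj₂
    obtain ⟨f, hf⟩ := (quot 𝒜).map_surjective (eqToHom hM.symm ≫ T.mor₁ ≫ eqToHom hN)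
    have e := isoTriangleOfIso₁₂ T (triangle f) hT (triangle_distinguished f) (eqToIso hM)
      (eqToIso hN) (by
        change T.mor₁ ≫ eqToHom hN = eqToHom hM ≫ (quot 𝒜).map f
        rw [hf]
        simp)
    exact ⟨_, hP f (hM ▸ h₁) (hN ▸ h₂), ⟨Triangle.π₃.mapIso e⟩⟩

instance : (torsion 𝒜).IsTriangulated :=
  have : (torsion 𝒜).IsTriangulatedClosed₃ :=
    isTriangulatedClosed₃_of_cone _ fun f h₁ h₂ => CDGMod.IsTorsion.cone h₁ h₂ f
  have : (torsion 𝒜).IsTriangulatedClosed₂ := .of_isTriangulatedClosed₃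
  have : (torsion 𝒜).ContainsZero :=
    ⟨(quot 𝒜).obj (zeroMod 𝒜), isZero_zeroMod, fun i m => ⟨0, rfl⟩⟩
  { }

/-- The modules with acyclic graded pieces of the kernel filtration, as objects of the homotopy
category. -/
def tAcyclic (𝒜 : CDGAlg k⟦X⟧) : ObjectProperty (Hot 𝒜) := fun M => CDGMod.IsTAcyclic M.as

lemma tAcyclic_quot_iff (M : CDGMod 𝒜) : tAcyclic 𝒜 ((quot 𝒜).obj M) ↔ M.IsTAcyclic := Iff.rfl

lemma tAcyclic_isClosedUnderIsomorphisms
    (hc : ∃ b : 𝒜.X 2, 𝒜.curv = (PowerSeries.X : k⟦X⟧) • b) :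
    (tAcyclic 𝒜).IsClosedUnderIsomorphisms where
  of_iso {M N} e hM := by
    obtain ⟨M, rfl⟩ := exists_quot_obj M
    obtain ⟨N, rfl⟩ := exists_quot_obj N
    obtain ⟨f, hf⟩ := (quot 𝒜).map_surjective e.hom
    obtain ⟨g, hg⟩ := (quot 𝒜).map_surjective e.inv
    have h : (quot 𝒜).map (𝟙 N) = (quot 𝒜).map (g ≫ f) := by
      rw [Functor.map_comp, hf, hg, e.inv_hom_id, CategoryTheory.Functor.map_id]
    exact IsTAcyclic.of_htpy hc (M := M) hM g f ((quot_map_eq_iff _ _).1 h)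

lemma tAcyclic_isTriangulated
    (hc : ∃ b : 𝒜.X 2, 𝒜.curv = (PowerSeries.X : k⟦X⟧) • b) :
    (tAcyclic 𝒜).IsTriangulated :=
  have : (tAcyclic 𝒜).IsStableUnderShift ℤ :=
    { isStableUnderShiftBy := fun n => ⟨fun M hM => by
        obtain ⟨M, rfl⟩ := exists_quot_obj M
        rw [ObjectProperty.prop_shift_iff, shift_quot_obj, tAcyclic_quot_iff]
        exact IsTAcyclic.shift hc hM n⟩ }
  have : (tAcyclic 𝒜).IsTriangulatedClosed₃ :=
    isTriangulatedClosed₃_of_cone _ fun f h₁ h₂ => CDGMod.IsTAcyclic.cone hc h₁ h₂ f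
  have : (tAcyclic 𝒜).IsTriangulatedClosed₂ := .of_isTriangulatedClosed₃
  have : (tAcyclic 𝒜).ContainsZero :=
    ⟨(quot 𝒜).obj (zeroMod 𝒜), isZero_zeroMod, by
      rw [tAcyclic_quot_iff, isTAcyclic_iff hc]
      exact fun i j₀ j j₁ h₀ h₁ m _ _ => ⟨0, rfl, rfl⟩⟩
  { }

end Hot

namespace FormalDeformation

variable {k : Type u} [CommRing k] {A : DGAlg k} (𝒟 : FormalDeformation A)

lemma exists_curv_eq : ∃ b : 𝒟.alg.X 2, 𝒟.alg.curv = (PowerSeries.X : k⟦X⟧) • b :=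
  (𝒟.proj_eq_zero_iff 2 _).1 (𝒟.proj_curv.trans A.curv_eq_zero)

/-- The element `c / t`, where `c` is the curvature; it is unique by torsion-freeness. -/
noncomputable def curvDivT : 𝒟.alg.X 2 := 𝒟.exists_curv_eq.choose

lemma smul_curvDivT : (PowerSeries.X : k⟦X⟧) • 𝒟.curvDivT = 𝒟.alg.curv :=
  𝒟.exists_curv_eq.choose_spec.symm

lemma d_curvDivT {j : ℤ} (h : 2 + 1 = j) : 𝒟.alg.d h 𝒟.curvDivT = 0 := by
  subst h
  refine 𝒟.torsionFree _ _ ?_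
  rw [← map_smul, smul_curvDivT]
  exact 𝒟.alg.d_curv

/-- The component of degree `j` of `t ^ n A_t`. -/
noncomputable abbrev tPow (n : ℕ) (j : ℤ) : Submodule k⟦X⟧ (𝒟.alg.X j) :=
  LinearMap.range (LinearMap.lsmul k⟦X⟧ (𝒟.alg.X j) (PowerSeries.X ^ n))

/-- The component of degree `j` of `A_t / t ^ n A_t`. -/
abbrev Quo (n : ℕ) (j : ℤ) : Type u := 𝒟.alg.X j ⧸ 𝒟.tPow n j

lemma tPow_le_comap (n : ℕ) {j l : ℤ} (f : 𝒟.alg.X j →ₗ[k⟦X⟧] 𝒟.alg.X l) :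
    𝒟.tPow n j ≤ (𝒟.tPow n l).comap f := by
  rintro _ ⟨x, rfl⟩
  exact ⟨f x, (map_smul f _ x).symm⟩

/-- The map on `A_t / t ^ n A_t` induced by a linear map. -/
noncomputable abbrev quoMap (n : ℕ) {j l : ℤ} (f : 𝒟.alg.X j →ₗ[k⟦X⟧] 𝒟.alg.X l) :
    𝒟.Quo n j →ₗ[k⟦X⟧] 𝒟.Quo n l :=
  Submodule.mapQ _ _ f (𝒟.tPow_le_comap n f)

/-- The map `t : A_t / t ^ n A_t ⟶ A_t / t ^ (n + 1) A_t`, `b ↦ t • b`, where `b = 1 * b` is used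
to identify components of equal degrees. -/
noncomputable def quoT (n : ℕ) {j l : ℤ} (h : 0 + j = l) : 𝒟.Quo n j →ₗ[k⟦X⟧] 𝒟.Quo (n + 1) l :=
  Submodule.mapQ _ _ ((PowerSeries.X : k⟦X⟧) • 𝒟.alg.mul h 𝒟.alg.one) (by
    rintro _ ⟨x, rfl⟩
    refine ⟨𝒟.alg.mul h 𝒟.alg.one x, ?_⟩
    change _ = (PowerSeries.X : k⟦X⟧) • 𝒟.alg.mul h 𝒟.alg.one ((PowerSeries.X ^ n : k⟦X⟧) • x)
    rw [map_smul, smul_smul, ← pow_succ']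
    rfl)

/-- The map `A_t / t ^ (n + 1) A_t ⟶ A_t / t ^ n A_t`, `a ↦ π (a * (c / t))`, where `π` is the
projection. -/
noncomputable def quoPi (n : ℕ) {j l : ℤ} (h : j + 2 = l) :
    𝒟.Quo (n + 1) j →ₗ[k⟦X⟧] 𝒟.Quo n l :=
  Submodule.mapQ _ _ ((𝒟.alg.mul h).flip 𝒟.curvDivT) (by
    rintro _ ⟨x, rfl⟩
    refine ⟨(PowerSeries.X : k⟦X⟧) • 𝒟.alg.mul h x 𝒟.curvDivT, ?_⟩
    change (PowerSeries.X ^ n : k⟦X⟧) • (PowerSeries.X : k⟦X⟧) • 𝒟.alg.mul h x 𝒟.curvDivT =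
      𝒟.alg.mul h ((PowerSeries.X ^ (n + 1) : k⟦X⟧) • x) 𝒟.curvDivT
    rw [map_smul, LinearMap.smul_apply, smul_smul, ← pow_succ])

/-- The left action of `A_t` on `A_t / t ^ n A_t`. -/
noncomputable def quoAct (n : ℕ) {i j l : ℤ} (h : i + j = l) :
    𝒟.alg.X i →ₗ[k⟦X⟧] 𝒟.Quo n j →ₗ[k⟦X⟧] 𝒟.Quo n l where
  toFun a := 𝒟.quoMap n (𝒟.alg.mul h a)
  map_add' a b := by
    ext x
    change Submodule.Quotient.mk (𝒟.alg.mul h (a + b) x) = _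
    rw [map_add]
    rfl
  map_smul' r a := by
    ext x
    change Submodule.Quotient.mk (𝒟.alg.mul h (r • a) x) = _
    rw [map_smul]
    rfl

/-- The component of degree `j` of `A_n ⊕ A_{n-1}[1]`, where `A_n = A_t / t ^ (n + 1) A_t`. -/
abbrev GammaX (n : ℕ) (j : ℤ) : Type u := 𝒟.Quo (n + 1) j × 𝒟.Quo n (j + 1)

/-- The class in `A_n ⊕ A_{n-1}[1]` of a pair of elements of `A_t`. -/
noncomputable def gammaMk (n : ℕ) (j : ℤ) (x : 𝒟.alg.X j) (y : 𝒟.alg.X (j + 1)) : 𝒟.GammaX n j :=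
  (Submodule.Quotient.mk x, Submodule.Quotient.mk y)

/-- The action of `A_t` on `A_n ⊕ A_{n-1}[1]`. -/
noncomputable def gammaAct (n : ℕ) {i j l : ℤ} (h : i + j = l) :
    𝒟.alg.X i →ₗ[k⟦X⟧] 𝒟.GammaX n j →ₗ[k⟦X⟧] 𝒟.GammaX n l :=
  LinearMap.mk₂ k⟦X⟧
    (fun a x => (𝒟.quoAct (n + 1) h a x.1,
      i.negOnePow • 𝒟.quoAct n (show i + (j + 1) = l + 1 by lia) a x.2))
    (fun a b x => by ext <;> simp) (fun r a x => Prod.ext (by simp) (by simp [smul_comm r]))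
    (fun a x y => by ext <;> simp) (fun r a x => Prod.ext (by simp) (by simp [smul_comm r]))

/-- The twisted predifferential `(a, b) ↦ (d a + t b, - d b + π (a * (c / t)))` of
`A_n ⊕ A_{n-1}[1]`. -/
noncomputable def gammaD (n : ℕ) {i j : ℤ} (h : i + 1 = j) :
    𝒟.GammaX n i →ₗ[k⟦X⟧] 𝒟.GammaX n j :=
  LinearMap.prod
    ((𝒟.quoMap (n + 1) (𝒟.alg.d h)).comp (LinearMap.fst _ _ _) +
      (𝒟.quoT n (show 0 + (i + 1) = j by lia)).comp (LinearMap.snd _ _ _))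
    (-(𝒟.quoMap n (𝒟.alg.d (show i + 1 + 1 = j + 1 by lia))).comp (LinearMap.snd _ _ _) +
      (𝒟.quoPi n (show i + 2 = j + 1 by lia)).comp (LinearMap.fst _ _ _))

lemma exists_gammaMk (n : ℕ) (j : ℤ) (x : 𝒟.GammaX n j) : ∃ a b, x = 𝒟.gammaMk n j a b := by
  obtain ⟨x, y⟩ := x
  obtain ⟨x, rfl⟩ := Submodule.Quotient.mk_surjective _ x
  obtain ⟨y, rfl⟩ := Submodule.Quotient.mk_surjective _ y
  exact ⟨x, y, rfl⟩

lemma gammaMk_add (n : ℕ) (j : ℤ) (x x' : 𝒟.alg.X j) (y y' : 𝒟.alg.X (j + 1)) :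
    𝒟.gammaMk n j (x + x') (y + y') = 𝒟.gammaMk n j x y + 𝒟.gammaMk n j x' y' := rfl

lemma smul_gammaMk (n : ℕ) (j : ℤ) (e : ℤˣ) (x : 𝒟.alg.X j) (y : 𝒟.alg.X (j + 1)) :
    e • 𝒟.gammaMk n j x y = 𝒟.gammaMk n j (e • x) (e • y) := by
  rcases CDGMod.units_cases e with h | h
  · simp [h]
  · simp only [h, Units.neg_smul, one_smul]
    rfl

lemma gammaAct_mk (n : ℕ) {i j l : ℤ} (h : i + j = l) (a : 𝒟.alg.X i) (x : 𝒟.alg.X j)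
    (y : 𝒟.alg.X (j + 1)) : 𝒟.gammaAct n h a (𝒟.gammaMk n j x y) =
      𝒟.gammaMk n l (𝒟.alg.mul h a x)
        (i.negOnePow • 𝒟.alg.mul (show i + (j + 1) = l + 1 by lia) a y) := by
  refine Prod.ext rfl ?_
  exact (CDGMod.map_units (Submodule.mkQ (𝒟.tPow n (l + 1))) _ _).symm

lemma gammaD_mk (n : ℕ) {i j : ℤ} (h : i + 1 = j) (x : 𝒟.alg.X i) (y : 𝒟.alg.X (i + 1)) :
    𝒟.gammaD n h (𝒟.gammaMk n i x y) = 𝒟.gammaMk n j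
      (𝒟.alg.d h x + (PowerSeries.X : k⟦X⟧) •
        𝒟.alg.mul (show 0 + (i + 1) = j by lia) 𝒟.alg.one y)
      (- 𝒟.alg.d (show i + 1 + 1 = j + 1 by lia) y +
        𝒟.alg.mul (show i + 2 = j + 1 by lia) x 𝒟.curvDivT) := rfl

/-- The cdg module `Γₙ`: the graded module `A_n ⊕ A_{n-1}[1]`, where `A_n = A_t / t ^ (n + 1) A_t`,
with predifferential `(a, b) ↦ (d a + t b, - d b + π (a * (c / t)))`. -/
noncomputable def Γ (n : ℕ) : CDGMod 𝒟.alg where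
  X j := 𝒟.GammaX n j
  act h := 𝒟.gammaAct n h
  d h := 𝒟.gammaD n h
  one_act {i} x := by
    obtain ⟨x, y, rfl⟩ := 𝒟.exists_gammaMk n _ x
    rw [gammaAct_mk, Int.negOnePow_zero, one_smul, 𝒟.alg.one_mul]
    congr 1
    exact 𝒟.alg.one_mul y
  mul_act {i j l ij jl m} h₁ h₂ h₃ h₄ a b x := by
    subst h₁
    obtain ⟨x, y, rfl⟩ := 𝒟.exists_gammaMk n _ x
    have e := 𝒟.alg.mul_assoc rfl (show (i + j) + (l + 1) = m + 1 by lia)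
      (show j + (l + 1) = jl + 1 by lia) (show i + (jl + 1) = m + 1 by lia) a b y
    rw [gammaAct_mk, gammaAct_mk, gammaAct_mk, 𝒟.alg.mul_assoc rfl h₂ h₃ h₄, e,
      CDGMod.map_units, smul_smul, Int.negOnePow_add]
  leibniz {i j l i' j' l'} h hi hj hl h₁ h₂ a x := by
    subst hi hj hl
    obtain ⟨x, y, rfl⟩ := 𝒟.exists_gammaMk n _ x
    rw [gammaAct_mk, gammaD_mk, gammaD_mk, gammaAct_mk, gammaAct_mk, smul_gammaMk, ← gammaMk_add]
    have e₁ := 𝒟.alg.leibniz h rfl rfl rfl h₁ h₂ a x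
    have e₂ := 𝒟.alg.leibniz (show i + (j + 1) = l + 1 by lia) rfl rfl rfl (by lia) (by lia) a y
    have e₃ := 𝒟.alg.mul_assoc (show 0 + i = i by lia) (show i + (j + 1) = l + 1 by lia)
      (show i + (j + 1) = l + 1 by lia) (show 0 + (l + 1) = l + 1 by lia) 𝒟.alg.one a y
    have e₄ := 𝒟.alg.mul_assoc (show i + 0 = i by lia) (show i + (j + 1) = l + 1 by lia)
      (show 0 + (j + 1) = j + 1 by lia) (show i + (j + 1) = l + 1 by lia) a 𝒟.alg.one y
    have e₅ := 𝒟.alg.mul_assoc h (show l + 2 = l + 1 + 1 by lia) (show j + 2 = j + 1 + 1 by lia)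
      (show i + (j + 1 + 1) = l + 1 + 1 by lia) a x 𝒟.curvDivT
    rw [𝒟.alg.one_mul] at e₃
    rw [𝒟.alg.mul_one] at e₄
    congr 1
    · rw [e₁, CDGMod.map_units, ← e₃, map_add, map_smul, ← e₄, smul_add, add_assoc,
        smul_comm i.negOnePow]
    · rw [CDGMod.map_units, e₂, e₅, map_add, map_neg, Int.negOnePow_succ]
      rcases CDGMod.units_cases i.negOnePow with h' | h' <;> simp [h'] <;> abel
  d_d {i j l} h h' h₁ x := by
    subst h h'
    obtain ⟨x, y, rfl⟩ := 𝒟.exists_gammaMk n _ x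
    rw [gammaD_mk, gammaD_mk, gammaAct_mk]
    have e₁ := 𝒟.alg.d_d (show i + 1 = i + 1 by rfl) (show i + 1 + 1 = i + 1 + 1 by rfl)
      (by lia) (by lia) x
    have e₂ := 𝒟.alg.d_d (show i + 1 + 1 = i + 1 + 1 by rfl)
      (show i + 1 + 1 + 1 = i + 1 + 1 + 1 by rfl) (by lia) (by lia) y
    have e₃ := 𝒟.alg.leibniz (show i + 2 = i + 1 + 1 by lia) rfl rfl rfl (by lia) (by lia)
      x 𝒟.curvDivT
    have hc := 𝒟.smul_curvDivT
    have e₄ (z : 𝒟.alg.X (i + 1 + 1)) : 𝒟.alg.mul (show 0 + (i + 1 + 1) = i + 1 + 1 by lia)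
      𝒟.alg.one z = z := 𝒟.alg.one_mul z
    have e₅ (z : 𝒟.alg.X (i + 1)) : 𝒟.alg.mul (show 0 + (i + 1) = i + 1 by lia)
      𝒟.alg.one z = z := 𝒟.alg.one_mul z
    have h2 : (2 : ℤ).negOnePow = 1 := Int.negOnePow_even _ (by simp)
    have e₆ : (PowerSeries.X : k⟦X⟧) • 𝒟.alg.mul (show i + 2 = i + 1 + 1 by lia) x 𝒟.curvDivT =
        𝒟.alg.mul (show i + 2 = i + 1 + 1 by lia) x 𝒟.alg.curv := by rw [← map_smul, hc]
    rw [h2, one_smul, e₄, e₅]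
    congr 1
    · rw [map_add, e₁, map_smul, smul_add, smul_neg, e₆]
      abel
    · rw [map_add, map_neg, e₂, e₃, 𝒟.d_curvDivT, map_zero, smul_zero, add_zero, map_add,
        map_smul, LinearMap.add_apply, LinearMap.smul_apply, ← map_smul, hc]
      abel

/-- `Γₙ` is a torsion module. -/
lemma isTorsion_Γ (n : ℕ) : (𝒟.Γ n).IsTorsion := fun j x => by
  obtain ⟨x, y, rfl⟩ := 𝒟.exists_gammaMk n _ x
  refine ⟨n + 1, ?_⟩
  refine Prod.ext ((Submodule.Quotient.mk_eq_zero _).2 ⟨x, rfl⟩)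
    ((Submodule.Quotient.mk_eq_zero _).2 ⟨(PowerSeries.X : k⟦X⟧) • y, ?_⟩)
  change (PowerSeries.X ^ n : k⟦X⟧) • (PowerSeries.X : k⟦X⟧) • y = (PowerSeries.X ^ (n + 1) : k⟦X⟧) • y
  rw [smul_smul, pow_succ]

/-- The homotopy category of torsion modules. -/
abbrev HotTor : Type (u + 1) := (Hot.torsion 𝒟.alg).FullSubcategory

/-- The `t`-acyclic torsion modules. -/
abbrev tAcyclic : ObjectProperty 𝒟.HotTor :=
  (Hot.tAcyclic 𝒟.alg).inverseImage (Hot.torsion 𝒟.alg).ι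

instance : (Hot.tAcyclic 𝒟.alg).IsClosedUnderIsomorphisms :=
  Hot.tAcyclic_isClosedUnderIsomorphisms 𝒟.exists_curv_eq

instance : (Hot.tAcyclic 𝒟.alg).IsTriangulated :=
  Hot.tAcyclic_isTriangulated 𝒟.exists_curv_eq

instance : 𝒟.tAcyclic.IsTriangulated := inferInstance

/-- The `t`-derived category of torsion modules: the Verdier quotient of the homotopy category of
torsion modules by the `t`-acyclic ones. -/
abbrev Dt : Type (u + 1) := 𝒟.tAcyclic.trW.Localization

/-- The quotient functor. -/
noncomputable abbrev Q : 𝒟.HotTor ⥤ 𝒟.Dt := 𝒟.tAcyclic.trW.Q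

/-- `Γₙ` as an object of the homotopy category of torsion modules. -/
noncomputable def ΓTor (n : ℕ) : 𝒟.HotTor := ⟨(Hot.quot 𝒟.alg).obj (𝒟.Γ n), 𝒟.isTorsion_Γ n⟩

end FormalDeformation

/-- An object `C` is compact if `Hom(C, -)` commutes with coproducts. -/
def IsCompactObj {C : Type*} [Category C] [Preadditive C] (X : C) : Prop :=
  ∀ J : Type u, PreservesColimitsOfShape (Discrete J) (preadditiveCoyoneda.obj (Opposite.op X))

namespace FormalDeformation

open CDGMod

variable {k : Type u} [CommRing k] {A : DGAlg k} (𝒟 : FormalDeformation A)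

/-! ### Maps out of `Γₙ` -/

/-- Every closed morphism `Γₙ[-j₀] ⟶ M` is null-homotopic, expressed through the images `m`, `p` of
the generators of `Γₙ`. -/
def IsGammaAcyclicAt (M : CDGMod 𝒟.alg) (n : ℕ) (j₀ : ℤ) : Prop :=
  ∀ {j₂ j₁ j₃ : ℤ} (h₂ : j₂ + 1 = j₁) (h₁ : j₁ + 1 = j₀) (h₀ : j₀ + 1 = j₃)
    (hc : 2 + j₁ = j₃) (hc' : 2 + j₂ = j₀) (m : M.X j₀) (p : M.X j₁),
    (PowerSeries.X ^ (n + 1) : k⟦X⟧) • m = 0 → (PowerSeries.X ^ n : k⟦X⟧) • p = 0 →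
    M.d h₀ m = M.act hc 𝒟.curvDivT p → M.d h₁ p = (PowerSeries.X : k⟦X⟧) • m →
    ∃ (m' : M.X j₁) (p' : M.X j₂), (PowerSeries.X ^ (n + 1) : k⟦X⟧) • m' = 0 ∧
      (PowerSeries.X ^ n : k⟦X⟧) • p' = 0 ∧ m = M.d h₁ m' + M.act hc' 𝒟.curvDivT p' ∧
      p = M.d h₂ p' + (PowerSeries.X : k⟦X⟧) • m'

/-- Exactness of `Grᵢ(M)`, expressed with elements of `M`. -/
def GrExact (M : CDGMod 𝒟.alg) (i : ℕ) : Prop :=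
  ∀ {j₀ j j₁ : ℤ} (h₀ : j₀ + 1 = j) (h₁ : j + 1 = j₁) (m : M.X j),
    (PowerSeries.X ^ (i + 1) : k⟦X⟧) • m = 0 → (PowerSeries.X ^ i : k⟦X⟧) • M.d h₁ m = 0 →
    ∃ m' : M.X j₀, (PowerSeries.X ^ (i + 1) : k⟦X⟧) • m' = 0 ∧
      (PowerSeries.X ^ i : k⟦X⟧) • (m - M.d h₀ m') = 0

variable {𝒟} {M : CDGMod 𝒟.alg}

lemma isTAcyclic_iff_grExact : M.IsTAcyclic ↔ ∀ i, 𝒟.GrExact M i :=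
  isTAcyclic_iff 𝒟.exists_curv_eq M

lemma d_d_eq {i j l : ℤ} (h : i + 1 = j) (h' : j + 1 = l) (h₁ : 2 + i = l) (m : M.X i) :
    M.d h' (M.d h m) = (PowerSeries.X : k⟦X⟧) • M.act h₁ 𝒟.curvDivT m := by
  rw [M.d_d h h' h₁, ← 𝒟.smul_curvDivT, map_smul, LinearMap.smul_apply]

lemma d_act_curvDivT {i j l m : ℤ} (h : i + 1 = j) (h₁ : 2 + i = l) (h₂ : l + 1 = m)
    (h₃ : 2 + j = m) (x : M.X i) :
    M.d h₂ (M.act h₁ 𝒟.curvDivT x) = M.act h₃ 𝒟.curvDivT (M.d h x) := by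
  have h2 : (2 : ℤ).negOnePow = 1 := Int.negOnePow_even _ (by simp)
  rw [M.leibniz h₁ rfl h h₂ (by lia) h₃, 𝒟.d_curvDivT, map_zero, LinearMap.zero_apply, zero_add,
    h2, one_smul]

lemma smul_pow_add_eq_zero {V : Type*} [AddCommGroup V] [Module k⟦X⟧ V] {n : ℕ} {v : V}
    (h : (PowerSeries.X ^ n : k⟦X⟧) • v = 0) : (PowerSeries.X ^ (n + 1) : k⟦X⟧) • v = 0 := by
  rw [pow_succ', mul_smul, h, smul_zero]

lemma smul_pow_smul_eq_zero {V : Type*} [AddCommGroup V] [Module k⟦X⟧ V] {n : ℕ} {v : V}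
    (h : (PowerSeries.X ^ (n + 1) : k⟦X⟧) • v = 0) :
    (PowerSeries.X ^ n : k⟦X⟧) • (PowerSeries.X : k⟦X⟧) • v = 0 := by
  rwa [smul_smul, ← pow_succ]

lemma exists_boundary_of_ker_pow {j₂ j₁ j₀ j₃ : ℤ} (h₂ : j₂ + 1 = j₁) (h₁ : j₁ + 1 = j₀)
    (h₀ : j₀ + 1 = j₃) (hc : 2 + j₁ = j₃) (hc' : 2 + j₂ = j₀) (n : ℕ)
    (H : ∀ i < n, 𝒟.GrExact M i) (m : M.X j₀) (p : M.X j₁)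
    (hm : (PowerSeries.X ^ n : k⟦X⟧) • m = 0) (hp : (PowerSeries.X ^ n : k⟦X⟧) • p = 0)
    (hdm : M.d h₀ m = M.act hc 𝒟.curvDivT p) (hdp : M.d h₁ p = (PowerSeries.X : k⟦X⟧) • m) :
    ∃ (m' : M.X j₁) (p' : M.X j₂), (PowerSeries.X ^ n : k⟦X⟧) • m' = 0 ∧
      (PowerSeries.X ^ n : k⟦X⟧) • p' = 0 ∧ m = M.d h₁ m' + M.act hc' 𝒟.curvDivT p' ∧
      p = M.d h₂ p' + (PowerSeries.X : k⟦X⟧) • m' := by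
  induction n generalizing m p with
  | zero =>
    rw [pow_zero, one_smul] at hm hp
    exact ⟨0, 0, by simp, by simp, by simp [hm], by simp [hp]⟩
  | succ n ih =>
    obtain ⟨p', hp', hp''⟩ := H n (Nat.lt_succ_self n) h₂ h₁ p hp
      (by rw [hdp]; exact smul_pow_smul_eq_zero hm)
    have hm₁ : (PowerSeries.X ^ (n + 1) : k⟦X⟧) • (m - M.act hc' 𝒟.curvDivT p') = 0 := by
      rw [smul_sub, hm, ← map_smul, hp', map_zero, sub_zero]
    have hdm₁ : M.d h₀ (m - M.act hc' 𝒟.curvDivT p') =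
        M.act hc 𝒟.curvDivT (p - M.d h₂ p') := by
      rw [map_sub, map_sub, hdm, d_act_curvDivT h₂ hc' h₀ hc]
    obtain ⟨m', hm', hm''⟩ := H n (Nat.lt_succ_self n) h₁ h₀ _ hm₁
      (by rw [hdm₁, ← map_smul, hp'', map_zero])
    obtain ⟨m₁, p₁, e₁, e₂, e₃, e₄⟩ := ih (fun i hi => H i (hi.trans (Nat.lt_succ_self n)))
      (m - M.act hc' 𝒟.curvDivT p' - M.d h₁ m')
      (p - M.d h₂ p' - (PowerSeries.X : k⟦X⟧) • m') hm''
      (by rw [smul_sub, hp'', smul_pow_smul_eq_zero hm', sub_zero])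
      (by rw [map_sub, hdm₁, d_d_eq h₁ h₀ hc, map_sub _ _ ((PowerSeries.X : k⟦X⟧) • m'), map_smul])
      (by rw [map_sub, map_sub, hdp, d_d_eq h₂ h₁ hc', map_smul, smul_sub, smul_sub])
    refine ⟨m' + m₁, p' + p₁, ?_, ?_, ?_, ?_⟩
    · rw [smul_add, hm', smul_pow_add_eq_zero e₁, add_zero]
    · rw [smul_add, hp', smul_pow_add_eq_zero e₂, add_zero]
    · rw [map_add, map_add, ← sub_eq_zero]
      rw [← sub_eq_zero] at e₃
      rw [← e₃]
      abel
    · rw [map_add, smul_add, ← sub_eq_zero]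
      rw [← sub_eq_zero] at e₄
      rw [← e₄]
      abel

lemma isGammaAcyclicAt_of_isTAcyclic (hM : M.IsTAcyclic) (n : ℕ) (j₀ : ℤ) :
    𝒟.IsGammaAcyclicAt M n j₀ := by
  intro j₂ j₁ j₃ h₂ h₁ h₀ hc hc' m p hm hp hdm hdp
  rw [isTAcyclic_iff_grExact] at hM
  obtain ⟨m', hm', hm''⟩ := hM n h₁ h₀ m hm (by rw [hdm, ← map_smul, hp, map_zero])
  obtain ⟨m₁, p₁, e₁, e₂, e₃, e₄⟩ := exists_boundary_of_ker_pow h₂ h₁ h₀ hc hc' n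
    (fun i _ => hM i) (m - M.d h₁ m') (p - (PowerSeries.X : k⟦X⟧) • m') hm''
    (by rw [smul_sub, hp, smul_pow_smul_eq_zero hm', sub_zero])
    (by rw [map_sub, hdm, d_d_eq h₁ h₀ hc, map_sub, map_smul])
    (by rw [map_sub, hdp, map_smul, smul_sub])
  refine ⟨m' + m₁, p₁, ?_, e₂, ?_, ?_⟩
  · rw [smul_add, hm', smul_pow_add_eq_zero e₁, add_zero]
  · rw [map_add, add_assoc, ← e₃]
    abel
  · rw [smul_add, add_left_comm, ← e₄]
    abel

lemma isTAcyclic_of_isGammaAcyclicAt (hM : ∀ n j₀, 𝒟.IsGammaAcyclicAt M n j₀) :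
    M.IsTAcyclic := by
  rw [isTAcyclic_iff_grExact]
  intro n
  induction n using Nat.strong_induction_on with
  | _ n ih =>
    intro j₁ j₀ j₃ h₁ h₀ m hm hdm
    obtain ⟨j₂, h₂⟩ : ∃ j₂, j₂ + 1 = j₁ := ⟨j₁ - 1, by lia⟩
    obtain ⟨x, p, hx, hp, e₁, e₂⟩ := exists_boundary_of_ker_pow h₁ h₀ rfl
      (show 2 + j₀ = j₃ + 1 by lia) (show 2 + j₁ = j₃ by lia) n ih (M.d h₀ m)
      ((PowerSeries.X : k⟦X⟧) • m) hdm (smul_pow_smul_eq_zero hm)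
      (by rw [d_d_eq h₀ rfl (by lia), map_smul]) (map_smul _ _ _)
    obtain ⟨m', p', hm', hp', e₃, e₄⟩ := hM n j₀ h₂ h₁ h₀ (by lia) (by lia) (m - x) p
      (by rw [smul_sub, hm, smul_pow_add_eq_zero hx, sub_zero]) hp
      (by rw [map_sub, e₁, add_sub_cancel_left])
      (by rw [smul_sub, e₂, add_sub_cancel_right])
    refine ⟨m', hm', ?_⟩
    have e : m - M.d h₁ m' = x + M.act (show 2 + j₂ = j₀ by lia) 𝒟.curvDivT p' := by
      rw [sub_eq_iff_eq_add] at e₃ ⊢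
      rw [e₃]
      abel
    rw [e, smul_add, hx, ← map_smul, hp', map_zero, add_zero]

lemma isGammaAcyclicAt_of_shift {n : ℕ} {j l : ℤ} (hM : 𝒟.IsGammaAcyclicAt (M.shift l) n j) :
    𝒟.IsGammaAcyclicAt M n (j + l) := by
  intro j₂ j₁ j₃ h₂ h₁ h₀ hc hc' m p hm hp hdm hdp
  obtain ⟨j₂, rfl⟩ : ∃ i, j₂ = i + l := ⟨j₂ - l, by lia⟩
  obtain ⟨j₁, rfl⟩ : ∃ i, j₁ = i + l := ⟨j₁ - l, by lia⟩
  obtain ⟨j₃, rfl⟩ : ∃ i, j₃ = i + l := ⟨j₃ - l, by lia⟩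
  have hl : (l * 2).negOnePow = 1 := Int.negOnePow_even _ (by simp)
  have hs (e : ℤˣ) {i : ℤ} (x : M.X i) (r : k⟦X⟧) (h : r • x = 0) : r • e • x = 0 := by
    rw [smul_comm, h, smul_zero]
  obtain ⟨m', p', e₁, e₂, e₃, e₄⟩ := hM (j₂ := j₂) (j₁ := j₁) (j₃ := j₃) (by lia) (by lia)
    (by lia) (by lia) (by lia) m (l.negOnePow • p : M.X (j₁ + l)) hm (hs _ p _ hp)
    (by
      rw [shift_d, shift_act, hl, one_smul, hdm]
      exact (map_units (M.act hc 𝒟.curvDivT) _ p).symm)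
    (by
      rw [shift_d]
      refine (congrArg (l.negOnePow • ·) (map_units (M.d h₁) l.negOnePow p)).trans ?_
      change l.negOnePow • l.negOnePow • M.d h₁ p = (PowerSeries.X : k⟦X⟧) • m
      rw [hdp, smul_smul, Int.units_mul_self, one_smul])
  rw [shift_d, shift_act, hl, one_smul] at e₃
  rw [shift_d] at e₄
  refine ⟨(l.negOnePow • m' : M.X (j₁ + l)), p', hs _ _ _ e₁, e₂, ?_, ?_⟩
  · rw [map_units]
    exact e₃
  · have := congrArg (fun x : M.X (j₁ + l) => l.negOnePow • x) e₄
    change l.negOnePow • l.negOnePow • p = l.negOnePow • (l.negOnePow • M.d h₂ p' +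
      (PowerSeries.X : k⟦X⟧) • m') at this
    rw [smul_add, smul_smul, smul_smul, Int.units_mul_self, one_smul, one_smul] at this
    rw [this]
    congr 1
    exact smul_comm _ _ _

end FormalDeformation

namespace FormalDeformation

open CDGMod

variable {k : Type u} [CommRing k] {A : DGAlg k} {𝒟 : FormalDeformation A} {M : CDGMod 𝒟.alg}

/-- The map `A_t / t ^ n A_t ⟶ M`, `a ↦ a * m`, for an element `m` annihilated by `t ^ n`. -/
noncomputable def quoLift (n : ℕ) {i j l : ℤ} (h : i + j = l) (m : M.X j)
    (hm : (PowerSeries.X ^ n : k⟦X⟧) • m = 0) : 𝒟.Quo n i →ₗ[k⟦X⟧] M.X l :=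
  Submodule.liftQ _ ((M.act h).flip m) (by
    rintro _ ⟨x, rfl⟩
    change M.act h ((PowerSeries.X ^ n : k⟦X⟧) • x) m = 0
    rw [map_smul, LinearMap.smul_apply, ← map_smul, hm, map_zero])

/-- The map `(x, y) ↦ ± x * m ± y * p` on `A_n ⊕ A_{n-1}[1]`. -/
noncomputable def gammaLift (n : ℕ) {i j j' l : ℤ} (h : i + j = l) (h' : i + 1 + j' = l)
    (e e' : ℤˣ) (m : M.X j) (p : M.X j') (hm : (PowerSeries.X ^ (n + 1) : k⟦X⟧) • m = 0)
    (hp : (PowerSeries.X ^ n : k⟦X⟧) • p = 0) : 𝒟.GammaX n i →ₗ[k⟦X⟧] M.X l :=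
  e • (quoLift (n + 1) h m hm).comp (LinearMap.fst _ _ _) +
    e' • (quoLift n h' p hp).comp (LinearMap.snd _ _ _)

lemma gammaLift_mk (n : ℕ) {i j j' l : ℤ} (h : i + j = l) (h' : i + 1 + j' = l)
    (e e' : ℤˣ) (m : M.X j) (p : M.X j') (hm : (PowerSeries.X ^ (n + 1) : k⟦X⟧) • m = 0)
    (hp : (PowerSeries.X ^ n : k⟦X⟧) • p = 0) (x : 𝒟.alg.X i) (y : 𝒟.alg.X (i + 1)) :
    gammaLift n h h' e e' m p hm hp (𝒟.gammaMk n i x y) =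
      e • M.act h x m + e' • M.act h' y p := rfl

/-- The closed morphism `Γₙ ⟶ M` which sends the generators of `Γₙ` to `m` and `p`. -/
noncomputable def gammaHom (n : ℕ) (m : M.X 0) (p : M.X (-1))
    (hm : (PowerSeries.X ^ (n + 1) : k⟦X⟧) • m = 0) (hp : (PowerSeries.X ^ n : k⟦X⟧) • p = 0)
    (hdm : M.d (show (0 : ℤ) + 1 = 1 by lia) m =
      M.act (show (2 : ℤ) + -1 = 1 by lia) 𝒟.curvDivT p)
    (hdp : M.d (show (-1 : ℤ) + 1 = 0 by lia) p = (PowerSeries.X : k⟦X⟧) • m) : 𝒟.Γ n ⟶ M where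
  f i := gammaLift n (add_zero i) (show i + 1 + -1 = i by lia) 1 (i + 1).negOnePow m p hm hp
  map_act {i j l} h a x := by
    obtain ⟨x, y, rfl⟩ := 𝒟.exists_gammaMk n _ x
    subst h
    refine (congrArg _ (𝒟.gammaAct_mk n rfl a x y)).trans ((gammaLift_mk ..).trans
      (Eq.trans ?_ (congrArg (M.act _ a) (gammaLift_mk ..).symm)))
    have e₁ := M.mul_act rfl (add_zero (i + j)) (add_zero j) rfl a x m
    have e₂ := M.mul_act (show i + (j + 1) = i + j + 1 by lia) (show i + j + 1 + -1 = i + j by lia)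
      (show j + 1 + -1 = j by lia) rfl a y p
    rw [one_smul, one_smul, map_add, e₁, map_units (M.act _ a), ← e₂]
    congr 1
    rcases units_cases i.negOnePow with h | h <;> rcases units_cases j.negOnePow with h' | h' <;>
      simp [h, h', Int.negOnePow_add]
  map_d {i j} h x := by
    obtain ⟨x, y, rfl⟩ := 𝒟.exists_gammaMk n _ x
    subst h
    refine (congrArg _ (𝒟.gammaD_mk n rfl x y)).trans ((gammaLift_mk ..).trans
      (Eq.trans ?_ (congrArg (M.d _) (gammaLift_mk ..).symm)))
    have e₁ := M.leibniz (add_zero i) rfl (show (0 : ℤ) + 1 = 1 by lia) rfl (add_zero (i + 1)) rfl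
      x m
    have e₂ := M.leibniz (show i + 1 + -1 = i by lia) rfl (show (-1 : ℤ) + 1 = 0 by lia) rfl
      (show i + 1 + 1 + -1 = i + 1 by lia) (add_zero (i + 1)) y p
    have e₃ := M.mul_act (show i + 2 = i + 1 + 1 by lia) (show i + 1 + 1 + -1 = i + 1 by lia)
      (show (2 : ℤ) + -1 = 1 by lia) rfl x 𝒟.curvDivT p
    have e₄ : 𝒟.alg.mul (show 0 + (i + 1) = i + 1 by lia) 𝒟.alg.one y = y := 𝒟.alg.one_mul y
    rw [one_smul, one_smul, map_add (M.d _), e₁, map_units (M.d _), e₂, hdm, hdp, ← e₃, e₄]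
    rcases units_cases i.negOnePow with h | h <;> simp [h, Int.negOnePow_succ] <;> abel

/-- The generator of `Γₙ` of degree `0`. -/
noncomputable def gammaGen₀ (n : ℕ) : (𝒟.Γ n).X 0 := 𝒟.gammaMk n 0 𝒟.alg.one 0

/-- The generator of `Γₙ` of degree `-1`. -/
noncomputable def gammaGen₁ (n : ℕ) : (𝒟.Γ n).X (-1) :=
  𝒟.gammaMk n (-1) 0 (show 𝒟.alg.X 0 from 𝒟.alg.one)

lemma smul_gammaMk_eq_zero (n : ℕ) {i : ℤ} (r : k⟦X⟧) (x : 𝒟.alg.X i) (y : 𝒟.alg.X (i + 1))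
    (hx : r • x ∈ 𝒟.tPow (n + 1) i) (hy : r • y ∈ 𝒟.tPow n (i + 1)) :
    r • 𝒟.gammaMk n i x y = 0 :=
  Prod.ext ((Submodule.Quotient.mk_eq_zero _).2 hx) ((Submodule.Quotient.mk_eq_zero _).2 hy)

lemma smul_gammaGen₀ (n : ℕ) : (PowerSeries.X ^ (n + 1) : k⟦X⟧) • 𝒟.gammaGen₀ n = 0 :=
  𝒟.smul_gammaMk_eq_zero n _ _ _ ⟨_, rfl⟩ (by rw [smul_zero]; exact zero_mem _)

lemma smul_gammaGen₁ (n : ℕ) : (PowerSeries.X ^ n : k⟦X⟧) • 𝒟.gammaGen₁ n = 0 :=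
  𝒟.smul_gammaMk_eq_zero n _ _ _ (by rw [smul_zero]; exact zero_mem _) ⟨_, rfl⟩

lemma alg_d_one {j : ℤ} (h : 0 + 1 = j) : 𝒟.alg.d h 𝒟.alg.one = 0 := by
  have := 𝒟.alg.leibniz (zero_add 0) h h h (by lia) (by lia) 𝒟.alg.one 𝒟.alg.one
  subst h
  rw [𝒟.alg.one_mul, Int.negOnePow_zero, one_smul] at this
  rw [show 𝒟.alg.mul _ 𝒟.alg.one (𝒟.alg.d _ 𝒟.alg.one) = _ from 𝒟.alg.one_mul _,
    show 𝒟.alg.mul _ (𝒟.alg.d _ 𝒟.alg.one) 𝒟.alg.one = _ from 𝒟.alg.mul_one _] at this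
  exact left_eq_add.1 this

lemma d_gammaGen₀ (n : ℕ) : (𝒟.Γ n).d (show (0 : ℤ) + 1 = 1 by lia) (𝒟.gammaGen₀ n) =
    (𝒟.Γ n).act (show (2 : ℤ) + -1 = 1 by lia) 𝒟.curvDivT (𝒟.gammaGen₁ n) := by
  refine (𝒟.gammaD_mk n _ _ _).trans (Eq.trans ?_ (𝒟.gammaAct_mk n _ _ _ _).symm)
  have h2 : (2 : ℤ).negOnePow = 1 := Int.negOnePow_even _ (by simp)
  rw [alg_d_one, map_zero, map_zero, map_zero, smul_zero, h2, one_smul]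
  congr 1
  · exact add_zero _
  refine (congrArg (· + _) neg_zero).trans ((zero_add _).trans ?_)
  exact (𝒟.alg.one_mul _).trans (𝒟.alg.mul_one _).symm

lemma d_gammaGen₁ (n : ℕ) : (𝒟.Γ n).d (show (-1 : ℤ) + 1 = 0 by lia) (𝒟.gammaGen₁ n) =
    (PowerSeries.X : k⟦X⟧) • 𝒟.gammaGen₀ n := by
  refine (𝒟.gammaD_mk n _ _ _).trans ?_
  change _ = 𝒟.gammaMk n 0 ((PowerSeries.X : k⟦X⟧) • 𝒟.alg.one) ((PowerSeries.X : k⟦X⟧) • 0)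
  rw [map_zero, map_zero, LinearMap.zero_apply, smul_zero, add_zero, zero_add]
  congr 1
  · exact congrArg _ (𝒟.alg.one_mul _)
  · exact neg_eq_zero.2 (𝒟.alg_d_one _)

lemma gammaMk_eq (n : ℕ) (i : ℤ) (x : 𝒟.alg.X i) (y : 𝒟.alg.X (i + 1)) :
    𝒟.gammaMk n i x y = (𝒟.Γ n).act (add_zero i) x (𝒟.gammaGen₀ n) +
      (i + 1).negOnePow • (𝒟.Γ n).act (show i + 1 + -1 = i by lia) y (𝒟.gammaGen₁ n) := by
  have e₀ : (𝒟.Γ n).act (add_zero i) x (𝒟.gammaGen₀ n) = 𝒟.gammaMk n i x 0 := by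
    refine (𝒟.gammaAct_mk n _ _ _ _).trans ?_
    rw [𝒟.alg.mul_one, map_zero, smul_zero]
  have e₁ : (𝒟.Γ n).act (show i + 1 + -1 = i by lia) y (𝒟.gammaGen₁ n) =
      𝒟.gammaMk n i 0 ((i + 1).negOnePow • y) := by
    refine (𝒟.gammaAct_mk n _ _ _ _).trans ?_
    rw [map_zero]
    congr 2
    exact 𝒟.alg.mul_one y
  rw [e₀, e₁]
  refine Eq.trans ?_ (congrArg (𝒟.gammaMk n i x 0 + ·) (𝒟.smul_gammaMk n i _ _ _).symm)
  refine Eq.trans ?_ (𝒟.gammaMk_add n i _ _ _ _)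
  rw [smul_zero, smul_smul, Int.units_mul_self, one_smul, add_zero, zero_add]

lemma hom_gammaMk {n : ℕ} (f : 𝒟.Γ n ⟶ M) (i : ℤ) (x : 𝒟.alg.X i) (y : 𝒟.alg.X (i + 1)) :
    Hom.f f i (𝒟.gammaMk n i x y) = M.act (add_zero i) x (Hom.f f 0 (𝒟.gammaGen₀ n)) +
      (i + 1).negOnePow • M.act (show i + 1 + -1 = i by lia) y
        (Hom.f f (-1) (𝒟.gammaGen₁ n)) := by
  rw [gammaMk_eq, map_add, map_units, f.map_act, f.map_act]

/-- The homotopy determined by its values `m'`, `p'` on the generators of `Γₙ`. -/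
noncomputable def gammaHtpy (n : ℕ) (m' : M.X (-1)) (p' : M.X (-2))
    (hm : (PowerSeries.X ^ (n + 1) : k⟦X⟧) • m' = 0)
    (hp : (PowerSeries.X ^ n : k⟦X⟧) • p' = 0) : Htpy (𝒟.Γ n) M where
  s {i j} h := gammaLift n (show i + -1 = j by lia) (show i + 1 + -2 = j by lia)
    i.negOnePow 1 m' p' hm hp
  map_act {i j l j' l'} h hj hl h' a x := by
    obtain ⟨x, y, rfl⟩ := 𝒟.exists_gammaMk n _ x
    subst h
    refine (congrArg _ (𝒟.gammaAct_mk n rfl a x y)).trans ((gammaLift_mk ..).trans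
      (Eq.trans ?_ (congrArg (fun z => i.negOnePow • M.act _ a z) (gammaLift_mk ..).symm)))
    have e₁ := M.mul_act rfl (show i + j + -1 = l' by lia) (show j + -1 = j' by lia) h' a x m'
    have e₂ := M.mul_act (show i + (j + 1) = i + j + 1 by lia) (show i + j + 1 + -2 = l' by lia)
      (show j + 1 + -2 = j' by lia) h' a y p'
    rw [one_smul, one_smul, map_add, map_units (M.act _ a), e₁, ← e₂, smul_add, smul_smul,
      Int.negOnePow_add]
    congr 1
    rcases units_cases i.negOnePow with h | h <;> simp [h]

lemma null_of_boundary {n : ℕ} (f : 𝒟.Γ n ⟶ M) (m' : M.X (-1)) (p' : M.X (-2))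
    (hm : (PowerSeries.X ^ (n + 1) : k⟦X⟧) • m' = 0)
    (hp : (PowerSeries.X ^ n : k⟦X⟧) • p' = 0)
    (h₀ : Hom.f f 0 (𝒟.gammaGen₀ n) = M.d (show (-1 : ℤ) + 1 = 0 by lia) m' +
      M.act (show (2 : ℤ) + -2 = 0 by lia) 𝒟.curvDivT p')
    (h₁ : Hom.f f (-1) (𝒟.gammaGen₁ n) = M.d (show (-2 : ℤ) + 1 = -1 by lia) p' +
      (PowerSeries.X : k⟦X⟧) • m') : Null f := by
  refine ⟨gammaHtpy n m' p' hm hp, fun {i j l} h h' x => ?_⟩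
  obtain ⟨x, y, rfl⟩ := 𝒟.exists_gammaMk n _ x
  subst h'
  refine Eq.trans ?_ (congrArg₂ (· + ·) (congrArg (M.d h) (gammaLift_mk ..).symm)
    ((gammaLift_mk ..).symm.trans (congrArg _ (𝒟.gammaD_mk n rfl x y).symm)))
  have e₁ := M.leibniz (show i + -1 = j by lia) rfl (show (-1 : ℤ) + 1 = 0 by lia) h
    (show i + 1 + -1 = i by lia) (add_zero i) x m'
  have e₂ := M.leibniz (show i + 1 + -2 = j by lia) rfl (show (-2 : ℤ) + 1 = -1 by lia) h
    (show i + 1 + 1 + -2 = i by lia) (show i + 1 + -1 = i by lia) y p'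
  have e₃ := M.mul_act (show i + 2 = i + 1 + 1 by lia) (show i + 1 + 1 + -2 = i by lia)
    (show (2 : ℤ) + -2 = 0 by lia) (add_zero i) x 𝒟.curvDivT p'
  have e₄ : 𝒟.alg.mul (show 0 + (i + 1) = i + 1 by lia) 𝒟.alg.one y = y := 𝒟.alg.one_mul y
  rw [hom_gammaMk, h₀, h₁, one_smul, one_smul, map_add (M.d _), map_units (M.d _), e₁, e₂, e₄,
    map_add (M.act _ x), ← e₃]
  rcases units_cases i.negOnePow with h | h <;> simp [h, Int.negOnePow_succ] <;> abel

end FormalDeformation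

namespace FormalDeformation

open CDGMod
open scoped ZeroObject

variable {k : Type u} [CommRing k] {A : DGAlg k} {𝒟 : FormalDeformation A}

lemma null_of_isGammaAcyclicAt {M : CDGMod 𝒟.alg} {n : ℕ} (hM : 𝒟.IsGammaAcyclicAt M n 0)
    (f : 𝒟.Γ n ⟶ M) : Null f := by
  obtain ⟨m', p', e₁, e₂, e₃, e₄⟩ := hM (show (-2 : ℤ) + 1 = -1 by lia)
    (show (-1 : ℤ) + 1 = 0 by lia) (show (0 : ℤ) + 1 = 1 by lia) (by lia) (by lia)
    (Hom.f f 0 (𝒟.gammaGen₀ n)) (Hom.f f (-1) (𝒟.gammaGen₁ n))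
    (by rw [← map_smul, smul_gammaGen₀, map_zero])
    (by rw [← map_smul, smul_gammaGen₁, map_zero])
    (by rw [← f.map_d, d_gammaGen₀, f.map_act])
    (by rw [← f.map_d, d_gammaGen₁, map_smul])
  exact null_of_boundary f m' p' e₁ e₂ e₃ e₄

lemma isGammaAcyclicAt_of_null {M : CDGMod 𝒟.alg} {n : ℕ} (hM : ∀ f : 𝒟.Γ n ⟶ M, Null f) :
    𝒟.IsGammaAcyclicAt M n 0 := by
  intro j₂ j₁ j₃ h₂ h₁ h₀ hc hc' m p hm hp hdm hdp
  obtain rfl : j₁ = -1 := by lia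
  obtain rfl : j₂ = -2 := by lia
  obtain rfl : j₃ = 1 := by lia
  obtain ⟨σ, hσ⟩ := hM (gammaHom n m p hm hp hdm hdp)
  refine ⟨σ.s h₁ (𝒟.gammaGen₀ n), σ.s h₂ (𝒟.gammaGen₁ n), ?_, ?_, ?_, ?_⟩
  · rw [← map_smul, smul_gammaGen₀, map_zero]
  · rw [← map_smul, smul_gammaGen₁, map_zero]
  · have e := hσ h₁ h₀ (𝒟.gammaGen₀ n)
    have h2 : (2 : ℤ).negOnePow = 1 := Int.negOnePow_even _ (by simp)
    rw [d_gammaGen₀, σ.map_act _ h₂ h₀ hc', h2, one_smul] at e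
    rw [← e]
    refine Eq.symm ((gammaLift_mk ..).trans ?_)
    rw [one_smul, M.one_act, map_zero, LinearMap.zero_apply, smul_zero, add_zero]
  · have e := hσ h₂ h₁ (𝒟.gammaGen₁ n)
    rw [d_gammaGen₁, map_smul] at e
    rw [← e]
    refine Eq.symm ((gammaLift_mk ..).trans ?_)
    rw [map_zero, LinearMap.zero_apply, smul_zero, zero_add, show (-1 + 1 : ℤ).negOnePow = 1 from Int.negOnePow_zero,
      one_smul]
    exact M.one_act p

lemma leftOrthogonal_ΓTor (n : ℕ) : 𝒟.tAcyclic.leftOrthogonal (𝒟.ΓTor n) := by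
  rintro ⟨Y, hY⟩ f hf
  obtain ⟨M, rfl⟩ := Hot.exists_quot_obj Y
  obtain ⟨g, hg⟩ := (Hot.quot 𝒟.alg).map_surjective f.hom
  refine (Hot.torsion 𝒟.alg).ι.map_injective ?_
  refine hg.symm.trans ((Hot.quot_map_eq_zero_iff g).2 ?_)
  exact null_of_isGammaAcyclicAt (isGammaAcyclicAt_of_isTAcyclic hf n 0) g

lemma Q_map_ΓTor_bijective (n : ℕ) (X : 𝒟.HotTor) :
    Function.Bijective (𝒟.Q.map : (𝒟.ΓTor n ⟶ X) → _) :=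
  (leftOrthogonal_ΓTor n).map_bijective_of_isTriangulated 𝒟.Q X

lemma Q_obj_surjective (Y : 𝒟.Dt) : ∃ X, 𝒟.Q.obj X = Y :=
  (Localization.Construction.objEquiv 𝒟.tAcyclic.trW).surjective Y

lemma isZero_Q_obj {X : 𝒟.HotTor} (hX : 𝒟.tAcyclic X) : IsZero (𝒟.Q.obj X) := by
  have h := Localization.inverts 𝒟.Q 𝒟.tAcyclic.trW (0 : 0 ⟶ X)
    (ObjectProperty.trW.mk _ (contractible_distinguished₁ X) hX)
  exact (Functor.map_isZero 𝒟.Q (isZero_zero 𝒟.HotTor)).of_iso (asIso (𝒟.Q.map (0 : 0 ⟶ X))).symm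

lemma hom_shift_eq_zero {n : ℕ} {X : 𝒟.HotTor}
    (H : ∀ (l : ℤ) (f : (𝒟.Q.obj (𝒟.ΓTor n))⟦l⟧ ⟶ 𝒟.Q.obj X), f = 0) (l : ℤ)
    (φ : 𝒟.ΓTor n ⟶ X⟦l⟧) : φ = 0 := by
  refine (Q_map_ΓTor_bijective n _).1 ?_
  rw [Functor.map_zero, ← cancel_mono ((𝒟.Q.commShiftIso l).hom.app X), zero_comp]
  refine (shiftFunctor 𝒟.Dt (-l)).map_injective ?_
  rw [Functor.map_zero, ← cancel_mono ((shiftFunctorCompIsoId 𝒟.Dt l (-l) (by lia)).hom.app _),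
    zero_comp]
  exact H _ _

lemma tAcyclic_of_hom_eq_zero {X : 𝒟.HotTor}
    (H : ∀ (n : ℕ) (l : ℤ) (f : (𝒟.Q.obj (𝒟.ΓTor n))⟦l⟧ ⟶ 𝒟.Q.obj X), f = 0) :
    𝒟.tAcyclic X := by
  change X.obj.as.IsTAcyclic
  refine isTAcyclic_of_isGammaAcyclicAt fun n l => ?_
  rw [← zero_add l]
  refine isGammaAcyclicAt_of_shift (isGammaAcyclicAt_of_null fun f => ?_)
  rw [← Hot.quot_map_eq_zero_iff]
  let e₁ : (Hot.quot 𝒟.alg).obj (X.obj.as⟦l⟧) ≅ X.obj⟦l⟧ :=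
    ((Hot.quot 𝒟.alg).commShiftIso l).app X.obj.as
  let e₂ : (X⟦l⟧).obj ≅ X.obj⟦l⟧ := ((Hot.torsion 𝒟.alg).ι.commShiftIso l).app X
  have e := congrArg (fun z => z.hom) (hom_shift_eq_zero (H n) l
    (ObjectProperty.homMk ((Hot.quot 𝒟.alg).map f ≫ (e₁ ≪≫ e₂.symm).hom)))
  exact (cancel_mono (e₁ ≪≫ e₂.symm).hom).1 (Eq.trans e zero_comp.symm)

theorem isZero_iff_forall_hom_eq_zero (Y : 𝒟.Dt) : IsZero Y ↔
      ∀ (n : ℕ) (l : ℤ) (f : (𝒟.Q.obj (𝒟.ΓTor n))⟦l⟧ ⟶ Y), f = 0 := by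
  refine ⟨fun h n l f => h.eq_of_tgt _ _, fun H => ?_⟩
  obtain ⟨X, rfl⟩ := Q_obj_surjective Y
  exact isZero_Q_obj (tAcyclic_of_hom_eq_zero H)

end FormalDeformation

namespace CDGMod

variable {R : Type u} [CommRing R] {𝒜 : CDGAlg R} {J : Type u}

/-! ### Direct sums -/

/-- The direct sum of a family of cdg modules. -/
def dsum (M : J → CDGMod 𝒜) : CDGMod 𝒜 where
  X i := Π₀ j, (M j).X i
  act h := LinearMap.mk₂ R (fun a => DFinsupp.mapRange.linearMap fun j => (M j).act h a)
    (fun a b x => by ext j; simp) (fun r a x => by ext j; simp) (fun a x y => map_add _ _ _)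
    (fun r a x => map_smul _ _ _)
  d h := DFinsupp.mapRange.linearMap fun j => (M j).d h
  one_act x := by
    ext j
    exact (M j).one_act (x j)
  mul_act h₁ h₂ h₃ h₄ a b x := by
    ext j
    exact (M j).mul_act h₁ h₂ h₃ h₄ a b (x j)
  leibniz {i j l i' j' l'} h hi hj hl h₁ h₂ a x := by
    ext s
    have := (M s).leibniz h hi hj hl h₁ h₂ a (x s)
    rcases units_cases i.negOnePow with h' | h' <;> simpa [h'] using this
  d_d h h' h₁ x := by
    ext j
    exact (M j).d_d h h' h₁ (x j)

variable (M : J → CDGMod 𝒜)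

/-- The projections of a direct sum. -/
def dsumProj (j : J) : dsum M ⟶ M j where
  f i := DFinsupp.lapply (M := fun j => (M j).X i) j
  map_act h a x := rfl
  map_d h x := rfl

open scoped Classical in
/-- The inclusions into a direct sum. -/
noncomputable def dsumIncl (j : J) : M j ⟶ dsum M where
  f i := DFinsupp.lsingle (M := fun j => (M j).X i) j
  map_act h a x := (DFinsupp.mapRange_single (f := fun j => (M j).act h a)
    (hf := fun _ => map_zero _)).symm
  map_d h x := (DFinsupp.mapRange_single (f := fun j => (M j).d h)
    (hf := fun _ => map_zero _)).symm

lemma dsumIncl_proj_self (j : J) : dsumIncl M j ≫ dsumProj M j = 𝟙 _ := by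
  classical
  ext i m
  exact DFinsupp.single_eq_same (β := fun j => (M j).X i)

lemma dsumIncl_proj_ne {j j' : J} (h : j ≠ j') : dsumIncl M j ≫ dsumProj M j' = 0 := by
  classical
  ext i m
  exact DFinsupp.single_eq_of_ne (β := fun j => (M j).X i) h.symm

variable {M}

lemma dsum_ext {i : ℤ} {x y : (dsum M).X i}
    (h : ∀ j, Hom.f (dsumProj M j) i x = Hom.f (dsumProj M j) i y) : x = y :=
  DFinsupp.ext h

lemma exists_finset_proj_eq_zero {i : ℤ} (x : (dsum M).X i) :
    ∃ S : Finset J, ∀ j ∉ S, Hom.f (dsumProj M j) i x = 0 := by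
  classical
  exact ⟨DFinsupp.support (β := fun j => (M j).X i) x,
    fun j hj => DFinsupp.notMem_support_iff.1 hj⟩

lemma dsum_eq_sum {i : ℤ} (x : (dsum M).X i) (S : Finset J)
    (hS : ∀ j ∉ S, Hom.f (dsumProj M j) i x = 0) :
    x = ∑ j ∈ S, Hom.f (dsumIncl M j) i (Hom.f (dsumProj M j) i x) := by
  refine dsum_ext fun j => ?_
  rw [map_sum]
  by_cases hj : j ∈ S
  · rw [Finset.sum_eq_single_of_mem j hj]
    · rw [← comp_f, dsumIncl_proj_self]
      rfl
    · intro j' _ hj'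
      rw [← comp_f (dsumIncl M j'), dsumIncl_proj_ne M hj']
      rfl
  · rw [hS j hj, Finset.sum_eq_zero]
    intro j' hj'
    rw [← comp_f (dsumIncl M j'), dsumIncl_proj_ne M (by rintro rfl; exact hj hj')]
    rfl

lemma dsum_linearMap_ext {i : ℤ} {V : Type*} [AddCommGroup V] [Module R V]
    {f g : (dsum M).X i →ₗ[R] V}
    (h : ∀ j m, f (Hom.f (dsumIncl M j) i m) = g (Hom.f (dsumIncl M j) i m)) : f = g := by
  ext x
  obtain ⟨S, hS⟩ := exists_finset_proj_eq_zero x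
  rw [dsum_eq_sum x S hS, map_sum, map_sum]
  exact Finset.sum_congr rfl fun j _ => h j _

open scoped Classical in
/-- The linear map out of a component of a direct sum with given restrictions to the summands. -/
noncomputable def dsumLift {i : ℤ} {V : Type*} [AddCommGroup V] [Module R V]
    (f : ∀ j, (M j).X i →ₗ[R] V) : (dsum M).X i →ₗ[R] V :=
  DFinsupp.lsum ℕ f

lemma dsumLift_incl {i : ℤ} {V : Type*} [AddCommGroup V] [Module R V]
    (f : ∀ j, (M j).X i →ₗ[R] V) (j : J) (m : (M j).X i) :
    dsumLift f (Hom.f (dsumIncl M j) i m) = f j m := by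
  classical
  exact DFinsupp.lsum_single ℕ f j m

/-- The morphism out of a direct sum with given restrictions to the summands. -/
noncomputable def dsumDesc {N : CDGMod 𝒜} (f : ∀ j, M j ⟶ N) : dsum M ⟶ N where
  f i := dsumLift fun j => (f j).f i
  map_act {i j l} h a x := by
    refine LinearMap.congr_fun (f := (dsumLift _).comp ((dsum M).act h a))
      (g := (N.act h a).comp (dsumLift _)) (dsum_linearMap_ext fun s m => ?_) x
    rw [LinearMap.comp_apply, LinearMap.comp_apply, ← Hom.map_act, dsumLift_incl, dsumLift_incl,
      Hom.map_act]
  map_d {i j} h x := by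
    refine LinearMap.congr_fun (f := (dsumLift _).comp ((dsum M).d h))
      (g := (N.d h).comp (dsumLift _)) (dsum_linearMap_ext fun s m => ?_) x
    rw [LinearMap.comp_apply, LinearMap.comp_apply, ← Hom.map_d, dsumLift_incl, dsumLift_incl,
      Hom.map_d]

lemma dsumIncl_desc {N : CDGMod 𝒜} (f : ∀ j, M j ⟶ N) (j : J) :
    dsumIncl M j ≫ dsumDesc f = f j := by
  ext i m
  exact dsumLift_incl (fun j => (f j).f i) j m

lemma null_of_incl {N : CDGMod 𝒜} (f : dsum M ⟶ N) (h : ∀ j, Null (dsumIncl M j ≫ f)) :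
    Null f := by
  choose σ hσ using h
  refine ⟨⟨fun {i j} h => dsumLift fun s => (σ s).s h, fun {i j l j' l'} h hj hl h' a x => ?_⟩,
    fun {i j l} h h' x => ?_⟩
  · refine LinearMap.congr_fun (f := (dsumLift _).comp ((dsum M).act h a))
      (g := i.negOnePow • (N.act h' a).comp (dsumLift _)) (dsum_linearMap_ext fun s m => ?_) x
    rw [LinearMap.comp_apply, ← Hom.map_act, dsumLift_incl, (σ s).map_act h hj hl h']
    rcases units_cases i.negOnePow with h | h <;> simp [h, dsumLift_incl]
  · refine LinearMap.congr_fun (f := f.f i) (g := (N.d h).comp (dsumLift _) +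
      (dsumLift _).comp ((dsum M).d h')) (dsum_linearMap_ext fun s m => ?_) x
    rw [LinearMap.add_apply, LinearMap.comp_apply, LinearMap.comp_apply, ← Hom.map_d,
      dsumLift_incl, dsumLift_incl, ← hσ s h h', comp_f]

/-- The direct sum of a family of morphisms. -/
noncomputable def dsumMap {N : J → CDGMod 𝒜} (f : ∀ j, M j ⟶ N j) : dsum M ⟶ dsum N :=
  dsumDesc fun j => f j ≫ dsumIncl N j

lemma dsumIncl_map {N : J → CDGMod 𝒜} (f : ∀ j, M j ⟶ N j) (j : J) :
    dsumIncl M j ≫ dsumMap f = f j ≫ dsumIncl N j := dsumIncl_desc _ _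

lemma dsumMap_proj {N : J → CDGMod 𝒜} (f : ∀ j, M j ⟶ N j) (j : J) :
    dsumMap f ≫ dsumProj N j = dsumProj M j ≫ f j := by
  apply hom_ext
  intro i x
  refine LinearMap.congr_fun (f := ((dsumMap f ≫ dsumProj N j).f i))
    (g := ((dsumProj M j ≫ f j).f i)) (dsum_linearMap_ext fun s m => ?_) x
  rw [← comp_f, ← comp_f, ← Category.assoc, dsumIncl_map, ← Category.assoc, Category.assoc]
  by_cases h : s = j
  · subst h
    rw [dsumIncl_proj_self, dsumIncl_proj_self, Category.comp_id, Category.id_comp]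
  · rw [dsumIncl_proj_ne _ h, dsumIncl_proj_ne _ h, comp_zero, zero_comp]

/-- The map of cones induced by a commutative square. -/
def coneMap {M N M' N' : CDGMod 𝒜} (f : M ⟶ N) (f' : M' ⟶ N') (a : M ⟶ M') (b : N ⟶ N')
    (h : f ≫ b = a ≫ f') : cone f ⟶ cone f' where
  f i := LinearMap.prodMap (a.f (i + 1)) (b.f i)
  map_act {i j l} h x m := by
    refine Prod.ext ?_ (b.map_act _ _ _)
    exact (map_units (a.f (l + 1)) _ _).trans (congrArg _ (a.map_act _ _ _))
  map_d {i j} h' m := by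
    have e : Hom.f (f ≫ b) j (M.cast h' m.1) = Hom.f (a ≫ f') j (M.cast h' m.1) := by rw [h]
    rw [comp_f, comp_f, a.map_cast] at e
    refine Prod.ext ((map_neg _ _).trans (congrArg _ (a.map_d _ _))) ?_
    refine (map_add (b.f j) _ _).trans ?_
    exact congrArg₂ (· + ·) e (b.map_d _ _)

/-- A module is `t`-acyclic if each of its elements is a finite sum of its components in `t`-acyclic
modules. -/
lemma isTAcyclic_of_decomposition {k : Type u} [CommRing k] {𝒜 : CDGAlg k⟦X⟧}
    (hc : ∃ b : 𝒜.X 2, 𝒜.curv = (PowerSeries.X : k⟦X⟧) • b) {C : CDGMod 𝒜} (D : J → CDGMod 𝒜)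
    (p : ∀ j, C ⟶ D j) (q : ∀ j, D j ⟶ C)
    (h : ∀ i (x : C.X i), ∃ S : Finset J, x = ∑ j ∈ S, Hom.f (q j) i (Hom.f (p j) i x))
    (hD : ∀ j, (D j).IsTAcyclic) : C.IsTAcyclic := by
  simp only [isTAcyclic_iff hc] at hD ⊢
  intro i j₀ j j₁ h₀ h₁ m hm hd
  have H (s : J) := hD s i h₀ h₁ (Hom.f (p s) j m) (by rw [← map_smul, hm, map_zero])
    (by rw [← Hom.map_d, ← map_smul, hd, map_zero])
  choose y hy hy' using H
  obtain ⟨S, hS⟩ := h j m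
  refine ⟨∑ s ∈ S, Hom.f (q s) j₀ (y s), ?_, ?_⟩
  · rw [Finset.smul_sum]
    refine Finset.sum_eq_zero fun s _ => ?_
    rw [← map_smul, hy, map_zero]
  · nth_rw 1 [hS]
    rw [map_sum, ← Finset.sum_sub_distrib, Finset.smul_sum]
    refine Finset.sum_eq_zero fun s _ => ?_
    rw [← Hom.map_d, ← map_sub, ← map_smul, hy', map_zero]

lemma isTAcyclic_cone_dsumMap {k : Type u} [CommRing k] {𝒜 : CDGAlg k⟦X⟧}
    (hc : ∃ b : 𝒜.X 2, 𝒜.curv = (PowerSeries.X : k⟦X⟧) • b) {M N : J → CDGMod 𝒜}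
    (f : ∀ j, M j ⟶ N j) (h : ∀ j, (cone (f j)).IsTAcyclic) : (cone (dsumMap f)).IsTAcyclic := by
  classical
  refine isTAcyclic_of_decomposition hc _ (fun j => coneMap _ _ _ _ (dsumMap_proj f j))
    (fun j => coneMap _ _ _ _ (dsumIncl_map f j).symm) (fun i x => ?_) h
  obtain ⟨S, hS⟩ := exists_finset_proj_eq_zero (M := M) x.1
  obtain ⟨T, hT⟩ := exists_finset_proj_eq_zero (M := N) x.2
  refine ⟨S ∪ T, Prod.ext ?_ ?_⟩
  · refine (dsum_eq_sum x.1 (S ∪ T) fun j hj => hS j fun h => hj (by simp [h])).trans ?_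
    let π : (cone (dsumMap f)).X i →ₗ[k⟦X⟧] (dsum M).X (i + 1) := LinearMap.fst _ _ _
    exact (map_sum π (fun j => Hom.f (coneMap _ _ _ _ (dsumIncl_map f j).symm) i
      (Hom.f (coneMap _ _ _ _ (dsumMap_proj f j)) i x)) (S ∪ T)).symm
  · refine (dsum_eq_sum x.2 (S ∪ T) fun j hj => hT j fun h => hj (by simp [h])).trans ?_
    let π : (cone (dsumMap f)).X i →ₗ[k⟦X⟧] (dsum N).X i := LinearMap.snd _ _ _
    exact (map_sum π (fun j => Hom.f (coneMap _ _ _ _ (dsumIncl_map f j).symm) i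
      (Hom.f (coneMap _ _ _ _ (dsumMap_proj f j)) i x)) (S ∪ T)).symm

lemma IsTorsion.dsum {k : Type u} [CommRing k] {𝒜 : CDGAlg k⟦X⟧} {M : J → CDGMod 𝒜}
    (h : ∀ j, (M j).IsTorsion) : (dsum M).IsTorsion := fun i x => by
  classical
  obtain ⟨S, hS⟩ := exists_finset_proj_eq_zero x
  choose n hn using fun j => h j i (Hom.f (dsumProj M j) i x)
  refine ⟨∑ j ∈ S, n j, dsum_ext fun j => ?_⟩
  rw [map_smul, map_zero]
  by_cases hj : j ∈ S
  · rw [← Finset.sum_erase_add _ _ hj, pow_add, mul_smul, hn, smul_zero]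
  · rw [hS j hj, smul_zero]

end CDGMod

/-! ### Coproducts in preadditive categories -/

section

variable {C : Type*} [Category C] [Preadditive C] {J : Type*} {X : J → C} {S : C}

/-- A criterion for a family of morphisms to be a coproduct in a preadditive category. -/
noncomputable def isColimitCofanMk (i : ∀ j, X j ⟶ S)
    (hex : ∀ {Z : C} (g : ∀ j, X j ⟶ Z), ∃ f : S ⟶ Z, ∀ j, i j ≫ f = g j)
    (hext : ∀ {Z : C} (f : S ⟶ Z), (∀ j, i j ≫ f = 0) → f = 0) : IsColimit (Cofan.mk S i) :=
  Cofan.IsColimit.mk _ (fun s => (hex s.inj).choose) (fun s => (hex s.inj).choose_spec)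
    (fun s m hm => sub_eq_zero.1 (hext _ fun j => by
      rw [Preadditive.comp_sub, sub_eq_zero]
      exact (hm j).trans ((hex s.inj).choose_spec j).symm))

/-- `Hom(G, -)` preserves a coproduct if all morphisms from `G` to it are finite sums of morphisms
to the summands. -/
lemma preservesColimit_coyoneda_of_decomposition (G : C) (i : ∀ j, X j ⟶ S)
    (hS : IsColimit (Cofan.mk S i))
    (h : ∀ f : G ⟶ S, ∃ (T : Finset J) (g : ∀ j, G ⟶ X j), f = ∑ j ∈ T, g j ≫ i j) :
    PreservesColimit (Discrete.functor X) (preadditiveCoyoneda.obj (Opposite.op G)) := by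
  classical
  have hπ (j : J) : ∃ p : S ⟶ X j, i j ≫ p = 𝟙 _ ∧ ∀ j' ≠ j, i j' ≫ p = 0 := by
    refine ⟨Cofan.IsColimit.desc hS fun j' => if e : j' = j then eqToHom (by rw [e]) else 0,
      ?_, fun j' hj' => ?_⟩
    · exact (Cofan.IsColimit.fac hS _ j).trans (by simp)
    · exact (Cofan.IsColimit.fac hS _ j').trans (by simp [hj'])
  choose p hp hp' using hπ
  have hfin (f : G ⟶ S) : {j | f ≫ p j ≠ 0}.Finite := by
    obtain ⟨T, g, rfl⟩ := h f
    refine T.finite_toSet.subset fun j hj => ?_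
    by_contra hjT
    refine hj ?_
    rw [Preadditive.sum_comp]
    refine Finset.sum_eq_zero fun j' hj' => ?_
    rw [Category.assoc, hp' j j' (by rintro rfl; exact hjT hj'), comp_zero]
  have hdesc (V : Type _) [AddCommGroup V] (φ : ∀ j, (G ⟶ X j) →+ V) :
      ∃ ψ : (G ⟶ S) →+ V, ∀ j g, ψ (g ≫ i j) = φ j g := by
    refine ⟨AddMonoidHom.mk' (fun f => ∑ᶠ j, φ j (f ≫ p j)) fun f f' => ?_, fun j g => ?_⟩
    · simp only [Preadditive.add_comp, map_add]
      refine finsum_add_distrib ((hfin f).subset fun j hj => ?_)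
        ((hfin f').subset fun j hj => ?_) <;>
      · intro h0
        refine hj ?_
        dsimp only
        rw [h0, map_zero]
    · refine (finsum_eq_single _ j fun j' hj' => ?_).trans ?_
      · rw [Category.assoc, hp' j' j hj'.symm, comp_zero, map_zero]
      · rw [Category.assoc, hp, Category.comp_id]
  refine preservesColimit_of_preserves_colimit_cocone hS ?_
  choose ψ hψ using fun s : Cocone (Discrete.functor X ⋙ preadditiveCoyoneda.obj (Opposite.op G)) =>
    hdesc s.pt fun j => (s.ι.app ⟨j⟩).hom
  refine ⟨fun s => AddCommGrpCat.ofHom (ψ s), fun s j => ?_, fun s m hm => ?_⟩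
  · ext g
    exact hψ s j.as g
  · ext f
    obtain ⟨T, g, hf⟩ := h f
    let μ : (G ⟶ S) →+ s.pt := m.hom
    refine (congrArg μ hf).trans (Eq.trans ?_ (congrArg (ψ s) hf).symm)
    rw [map_sum, map_sum]
    refine Finset.sum_congr rfl fun j _ => ?_
    rw [hψ]
    exact congrArg (fun z => z.hom (g j)) (hm ⟨j⟩)

end

namespace FormalDeformation

open CDGMod

variable {k : Type u} [CommRing k] {A : DGAlg k} {𝒟 : FormalDeformation A} {J : Type u}

/-! ### Coproducts in the `t`-derived category -/

/-- The direct sum of a family of torsion modules, as an object of the homotopy category. -/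
noncomputable def torSum (X : J → 𝒟.HotTor) : 𝒟.HotTor :=
  ⟨(Hot.quot 𝒟.alg).obj (dsum fun j => (X j).obj.as), IsTorsion.dsum fun j => (X j).property⟩

/-- The inclusions into a direct sum of torsion modules. -/
noncomputable def torIncl (X : J → 𝒟.HotTor) (j : J) : X j ⟶ torSum X :=
  ObjectProperty.homMk ((Hot.quot 𝒟.alg).map (dsumIncl (fun j => (X j).obj.as) j))

lemma exists_hom_eq {X Y : 𝒟.HotTor} (f : X ⟶ Y) : ∃ g : X.obj.as ⟶ Y.obj.as,
    f = ObjectProperty.homMk ((Hot.quot 𝒟.alg).map g) := by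
  obtain ⟨g, hg⟩ := (Hot.quot 𝒟.alg).map_surjective f.hom
  exact ⟨g, (Hot.torsion 𝒟.alg).ι.map_injective hg.symm⟩

lemma homMk_comp_homMk {X Y Z : 𝒟.HotTor} (f : X.obj.as ⟶ Y.obj.as) (g : Y.obj.as ⟶ Z.obj.as) :
    (ObjectProperty.homMk ((Hot.quot 𝒟.alg).map f) : X ⟶ Y) ≫
      (ObjectProperty.homMk ((Hot.quot 𝒟.alg).map g) : Y ⟶ Z) =
        ObjectProperty.homMk ((Hot.quot 𝒟.alg).map (f ≫ g)) :=
  (Hot.torsion 𝒟.alg).ι.map_injective ((Hot.quot 𝒟.alg).map_comp f g).symm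

lemma exists_torDesc {X : J → 𝒟.HotTor} {Z : 𝒟.HotTor} (g : ∀ j, X j ⟶ Z) :
    ∃ f : torSum X ⟶ Z, ∀ j, torIncl X j ≫ f = g j := by
  choose φ hφ using fun j => exists_hom_eq (g j)
  refine ⟨ObjectProperty.homMk ((Hot.quot 𝒟.alg).map (dsumDesc φ)), fun j => ?_⟩
  rw [hφ, ← dsumIncl_desc φ j]
  exact homMk_comp_homMk (Y := torSum X) (dsumIncl (fun j => (X j).obj.as) j) (dsumDesc φ)

lemma homMk_eq_zero_iff {X Y : 𝒟.HotTor} (f : X.obj.as ⟶ Y.obj.as) :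
    (ObjectProperty.homMk ((Hot.quot 𝒟.alg).map f) : X ⟶ Y) = 0 ↔ Null f := by
  rw [← Hot.quot_map_eq_zero_iff]
  exact ⟨fun h => congrArg (fun z => z.hom) h, fun h => (Hot.torsion 𝒟.alg).ι.map_injective h⟩

lemma torSum_hom_ext {X : J → 𝒟.HotTor} {Z : 𝒟.HotTor} (f : torSum X ⟶ Z)
    (h : ∀ j, torIncl X j ≫ f = 0) : f = 0 := by
  obtain ⟨g, rfl⟩ := exists_hom_eq f
  refine (homMk_eq_zero_iff (X := torSum X) g).2 (null_of_incl g fun j => ?_)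
  refine (homMk_eq_zero_iff (X := X j) (dsumIncl (fun j => (X j).obj.as) j ≫ g)).1 ?_
  rw [← h j]
  exact (homMk_comp_homMk (Y := torSum X) (dsumIncl (fun j => (X j).obj.as) j) g).symm

lemma trW_homMk_iff {X Y : 𝒟.HotTor} (f : X.obj.as ⟶ Y.obj.as) :
    𝒟.tAcyclic.trW (ObjectProperty.homMk ((Hot.quot 𝒟.alg).map f) : X ⟶ Y) ↔
      (cone f).IsTAcyclic :=
  (ObjectProperty.inverseImage_trW_iff _ _ _).trans
    (ObjectProperty.trW_iff_of_distinguished _ _ (Hot.triangle_distinguished f))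

lemma exists_torMap {W X : J → 𝒟.HotTor} (s : ∀ j, W j ⟶ X j)
    (hs : ∀ j, 𝒟.tAcyclic.trW (s j)) :
    ∃ f : torSum W ⟶ torSum X, 𝒟.tAcyclic.trW f ∧
      ∀ j, torIncl W j ≫ f = s j ≫ torIncl X j := by
  choose φ hφ using fun j => exists_hom_eq (s j)
  refine ⟨ObjectProperty.homMk ((Hot.quot 𝒟.alg).map (dsumMap φ)), ?_, fun j => ?_⟩
  · refine (trW_homMk_iff (X := torSum W) (Y := torSum X) _).2
      (isTAcyclic_cone_dsumMap 𝒟.exists_curv_eq φ fun j => ?_)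
    exact (trW_homMk_iff (φ j)).1 (hφ j ▸ hs j)
  · rw [hφ]
    refine (homMk_comp_homMk (X := W j) (Y := torSum W) (Z := torSum X)
      (dsumIncl (fun j => (W j).obj.as) j) (dsumMap φ)).trans ?_
    refine Eq.trans (congrArg (fun z => ObjectProperty.homMk ((Hot.quot 𝒟.alg).map z))
      (dsumIncl_map φ j)) ?_
    exact (homMk_comp_homMk (Y := X j) (Z := torSum X) (φ j)
      (dsumIncl (fun j => (X j).obj.as) j)).symm

lemma exists_Q_desc {X : J → 𝒟.HotTor} {Y : 𝒟.Dt} (g : ∀ j, 𝒟.Q.obj (X j) ⟶ Y) :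
    ∃ f : 𝒟.Q.obj (torSum X) ⟶ Y, ∀ j, 𝒟.Q.map (torIncl X j) ≫ f = g j := by
  obtain ⟨Z, rfl⟩ := Q_obj_surjective Y
  choose φ hφ using fun j => Localization.exists_rightFraction 𝒟.Q 𝒟.tAcyclic.trW (g j)
  obtain ⟨s, hs, hs'⟩ := exists_torMap (fun j => (φ j).s) (fun j => (φ j).hs)
  obtain ⟨d, hd⟩ := exists_torDesc fun j => (φ j).f
  have := Localization.inverts 𝒟.Q 𝒟.tAcyclic.trW s hs
  refine ⟨inv (𝒟.Q.map s) ≫ 𝒟.Q.map d, fun j => ?_⟩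
  have := Localization.inverts 𝒟.Q 𝒟.tAcyclic.trW _ (φ j).hs
  rw [← cancel_epi (𝒟.Q.map (φ j).s), ← Category.assoc, ← Functor.map_comp, ← hs', hφ,
    MorphismProperty.RightFraction.map_s_comp_map, Functor.map_comp, Category.assoc,
    IsIso.hom_inv_id_assoc, ← Functor.map_comp, hd]

lemma Q_torSum_hom_ext {X : J → 𝒟.HotTor} {Y : 𝒟.Dt} (f : 𝒟.Q.obj (torSum X) ⟶ Y)
    (h : ∀ j, 𝒟.Q.map (torIncl X j) ≫ f = 0) : f = 0 := by
  obtain ⟨Z, rfl⟩ := Q_obj_surjective Y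
  obtain ⟨φ, rfl⟩ := Localization.exists_leftFraction 𝒟.Q 𝒟.tAcyclic.trW f
  have := Localization.inverts 𝒟.Q 𝒟.tAcyclic.trW _ φ.hs
  have H (j : J) : ∃ (W : 𝒟.HotTor) (s : W ⟶ X j), 𝒟.tAcyclic.trW s ∧
      s ≫ torIncl X j ≫ φ.f = 0 := by
    have e : 𝒟.Q.map (torIncl X j ≫ φ.f) = 𝒟.Q.map 0 := by
      rw [Functor.map_comp, ← MorphismProperty.LeftFraction.map_comp_map_s φ 𝒟.Q
        (Localization.inverts _ _), ← Category.assoc, h, zero_comp, Functor.map_zero]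
    obtain ⟨W, s, hs, e⟩ := (MorphismProperty.map_eq_iff_precomp 𝒟.Q 𝒟.tAcyclic.trW _ _).1 e
    exact ⟨W, s, hs, e.trans comp_zero⟩
  choose W s hs hs' using H
  obtain ⟨σ, hσ, hσ'⟩ := exists_torMap s hs
  have e : σ ≫ φ.f = 0 := torSum_hom_ext _ fun j => by
    rw [← Category.assoc, hσ', Category.assoc, hs']
  have := Localization.inverts 𝒟.Q 𝒟.tAcyclic.trW _ hσ
  rw [← cancel_epi (𝒟.Q.map σ), ← cancel_mono (𝒟.Q.map φ.s), Category.assoc,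
    MorphismProperty.LeftFraction.map_comp_map_s, ← Functor.map_comp, e, Functor.map_zero,
    comp_zero, zero_comp]

/-- Direct sums of torsion modules are coproducts in the `t`-derived category. -/
noncomputable def isColimitQTorSum (X : J → 𝒟.HotTor) :
    IsColimit (Cofan.mk (𝒟.Q.obj (torSum X)) fun j => 𝒟.Q.map (torIncl X j)) :=
  isColimitCofanMk _ exists_Q_desc Q_torSum_hom_ext

lemma exists_iso_Q (K : Discrete J ⥤ 𝒟.Dt) :
    ∃ X : J → 𝒟.HotTor, Nonempty (Discrete.functor (fun j => 𝒟.Q.obj (X j)) ≅ K) := by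
  choose X hX using fun j => Q_obj_surjective (K.obj ⟨j⟩)
  exact ⟨X, ⟨Discrete.natIso fun j => eqToIso (hX j.as)⟩⟩

instance hasCoproducts_Dt : HasCoproducts.{u} 𝒟.Dt := fun J => ⟨fun K => by
  obtain ⟨X, ⟨e⟩⟩ := exists_iso_Q K
  have : HasColimit (Discrete.functor fun j => 𝒟.Q.obj (X j)) := ⟨_, isColimitQTorSum X⟩
  exact hasColimit_of_iso e.symm⟩

lemma Γ_hom_ext {n : ℕ} {M : CDGMod 𝒟.alg} {f g : 𝒟.Γ n ⟶ M}
    (h₀ : Hom.f f 0 (𝒟.gammaGen₀ n) = Hom.f g 0 (𝒟.gammaGen₀ n))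
    (h₁ : Hom.f f (-1) (𝒟.gammaGen₁ n) = Hom.f g (-1) (𝒟.gammaGen₁ n)) : f = g := by
  apply hom_ext
  intro i x
  obtain ⟨x, y, rfl⟩ := 𝒟.exists_gammaMk n _ x
  rw [hom_gammaMk, hom_gammaMk, h₀, h₁]

lemma sum_f {R : Type u} [CommRing R] {𝒜 : CDGAlg R} {M N : CDGMod 𝒜} (T : Finset J)
    (f : J → (M ⟶ N)) (i : ℤ) (m : M.X i) :
    Hom.f (∑ j ∈ T, f j : M ⟶ N) i m = ∑ j ∈ T, Hom.f (f j) i m := by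
  classical
  induction T using Finset.induction_on with
  | empty => rfl
  | insert j T hj ih => rw [Finset.sum_insert hj, Finset.sum_insert hj, add_f, ih]

lemma exists_sum_of_hom_dsum {n : ℕ} {M : J → CDGMod 𝒟.alg} (f : 𝒟.Γ n ⟶ dsum M) :
    ∃ T : Finset J, f = ∑ j ∈ T, (f ≫ dsumProj M j) ≫ dsumIncl M j := by
  classical
  obtain ⟨S, hS⟩ := exists_finset_proj_eq_zero (Hom.f f 0 (𝒟.gammaGen₀ n))
  obtain ⟨T, hT⟩ := exists_finset_proj_eq_zero (Hom.f f (-1) (𝒟.gammaGen₁ n))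
  refine ⟨S ∪ T, Γ_hom_ext ?_ ?_⟩
  · rw [sum_f]
    exact dsum_eq_sum _ (S ∪ T) fun j hj => hS j fun h => hj (by simp [h])
  · rw [sum_f]
    exact dsum_eq_sum _ (S ∪ T) fun j hj => hT j fun h => hj (by simp [h])

/-- The map from closed morphisms to morphisms in the `t`-derived category. -/
noncomputable def homToDt (X Y : 𝒟.HotTor) :
    (X.obj.as ⟶ Y.obj.as) →+ (𝒟.Q.obj X ⟶ 𝒟.Q.obj Y) :=
  AddMonoidHom.mk' (fun g => 𝒟.Q.map (ObjectProperty.homMk ((Hot.quot 𝒟.alg).map g)))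
    fun f g => by
      rw [← Functor.map_add]
      exact congrArg 𝒟.Q.map
        ((Hot.torsion 𝒟.alg).ι.map_injective ((Hot.quot 𝒟.alg).map_add (f := f) (g := g)))

lemma exists_sum_of_hom_Q {n : ℕ} {X : J → 𝒟.HotTor}
    (f : 𝒟.Q.obj (𝒟.ΓTor n) ⟶ 𝒟.Q.obj (torSum X)) :
    ∃ (T : Finset J) (g : ∀ j, 𝒟.Q.obj (𝒟.ΓTor n) ⟶ 𝒟.Q.obj (X j)),
      f = ∑ j ∈ T, g j ≫ 𝒟.Q.map (torIncl X j) := by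
  obtain ⟨f, rfl⟩ := (Q_map_ΓTor_bijective n _).2 f
  obtain ⟨φ, rfl⟩ := exists_hom_eq f
  obtain ⟨T, hT⟩ := exists_sum_of_hom_dsum (𝒟 := 𝒟) (n := n) (M := fun j => (X j).obj.as) φ
  refine ⟨T, fun j => homToDt (𝒟.ΓTor n) (X j) (φ ≫ dsumProj (fun j => (X j).obj.as) j), ?_⟩
  refine (congrArg (homToDt (𝒟.ΓTor n) (torSum X)) hT).trans ((map_sum _ _ _).trans
    (Finset.sum_congr rfl fun j _ => ?_))
  refine Eq.trans ?_ (𝒟.Q.map_comp _ _)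
  exact congrArg 𝒟.Q.map (homMk_comp_homMk (X := 𝒟.ΓTor n) (Y := X j) (Z := torSum X)
    (φ ≫ dsumProj (fun j => (X j).obj.as) j) (dsumIncl (fun j => (X j).obj.as) j)).symm

theorem isCompactObj_ΓTor (n : ℕ) : IsCompactObj.{u} (𝒟.Q.obj (𝒟.ΓTor n)) :=
  fun J => ⟨fun {K} => by
    obtain ⟨X, ⟨e⟩⟩ := exists_iso_Q K
    have := preservesColimit_coyoneda_of_decomposition (𝒟.Q.obj (𝒟.ΓTor n)) _
      (isColimitQTorSum X) exists_sum_of_hom_Q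
    exact preservesColimit_of_iso_diagram _ e⟩

end FormalDeformation

theorem mainTheorem12 {k : Type u} [CommRing k] (A : DGAlg k) (𝒟 : FormalDeformation A) :
    (∀ n : ℕ, 𝒟.tAcyclic.leftOrthogonal (𝒟.ΓTor n)) ∧
    HasCoproducts.{u} 𝒟.Dt ∧
    (∀ n : ℕ, IsCompactObj.{u} (𝒟.Q.obj (𝒟.ΓTor n))) ∧
    (∀ Y : 𝒟.Dt, IsZero Y ↔
      ∀ (n : ℕ) (l : ℤ) (f : (𝒟.Q.obj (𝒟.ΓTor n))⟦l⟧ ⟶ Y), f = 0) :=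
  ⟨FormalDeformation.leftOrthogonal_ΓTor, FormalDeformation.hasCoproducts_Dt,
    FormalDeformation.isCompactObj_ΓTor, FormalDeformation.isZero_iff_forall_hom_eq_zero⟩
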